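/- Work in the plane $\mathbb C$. For $w\in\mathbb C\setminus\{0\}$ let $\arg w\in[0,2\pi)$. An arc is a homeomorphic image $\Lambda$ of $[0,1]$; for $x,y\in\Lambda$ let $\Lambda(x,y)$ be the subarc of $\Lambda$ between $x$ and $y$. For $t\ge 1$, an arc $\Lambda$ is a *$t$-quasi-arc* if there is $c>0$ with $(\operatorname{diam}\Lambda(x,y))^t\le c\,|x-y|$ for all $x,y\in\Lambda$. Let $z_0,\dots,z_\ell\in\mathbb C$ be the distinct successive vertices of a polygonal line and let $0<q<\ell$ satisfy $\operatorname{Im}\frac{z_q-z_0}{z_\ell-z_0}>0$. Let $\Pi_0$ be the interior of the triangle $z_0z_\ell z_q$, let $\Pi_1$ be its closure, and for $1\le j\le\ell$ let $S_j$ be the orientation preserving similitude with $S_j(z_0)=z_{j-1}$ and $S_j(z_\ell)=z_j$. The polygonal line is a *basic figure* if: $z_1,z_{\ell-1}\in\overline{z_0z_\ell}$ and $z_{\ell-1}\in\overline{z_1z_\ell}$; every $z_j$ lies in $\{z_q\}\cup\overline{z_0z_\ell}\cup\Pi_0$; every $S_j$ is contractive; the sets $S_j(\Pi_0)$ are pairwise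 disjoint; $S_j(z_q)\in\Pi_1$ for all $j$; and $S_j(\Pi_1)\cap(\overline{z_qz_0}\cup\overline{z_qz_\ell})=\emptyset$ for $j\notin\{1,\ell,q,q+1\}$. Its corner angles are $$\theta_p=\arg\frac{S_p(z_q)-z_p}{S_{p+1}(z_q)-z_p}\quad(1\le p\le\ell-1),\qquad \theta_{\min}=\min_p\theta_p,$$ and its characteristic angle is $\theta_{\min}+\min(\eta_1,\eta_2)$, where $$\eta_1=\arg\frac{S_q(z_q)-z_q}{z_0-z_q},\qquad \eta_2=\arg\frac{z_\ell-z_q}{S_{q+1}(z_q)-z_q}.$$ A *regular self-similar arc* is the non-empty compact set $\Lambda=\bigcup_{j=1}^{\ell}S_j(\Lambda)$ of a basic figure with positive characteristic angle, provided that $\Lambda$ is an arc, that $S_j(\Lambda)\cap S_{j+1}(\Lambda)$ is a single point for $1\le j<\ell$, and that $S_i(\Lambda)\cap S_j(\Lambda)=\emptyset$ for $|i-j|>1$. **Theorem.** (1) There is a regular self-similar arc with $\theta_{\min}=0$ that is a $t$-quasi-arc for no $t\ge 1$. (2) For each $t_0>1$ there is a regular self-similar arc with $\theta_{\min}=0$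 that is a $t_0$-quasi-arc but is a $t$-quasi-arc for no $t\in[1,t_0)$. (3) For each $t_0\ge 1$ there is a regular self-similar arc with $\theta_{\min}=0$ that is a $t$-quasi-arc for every $t>t_0$ but is not a $t_0$-quasi-arc. -/

import Mathlib

noncomputable section

namespace RegularArc

/-- `h` parametrizes the arc `Λ`: it is a homeomorphism of `[0,1]` onto `Λ` (a continuous
injection of the compact interval into a metric space is a homeomorphism onto its range). -/
structure IsArcParam {E : Type*} [MetricSpace E] (Λ : Set E) (h : unitInterval → E) : Prop where
  continuous : Continuous h
  injective : Function.Injective h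
  range_eq : Set.range h = Λ

/-- An arc: a homeomorphic image of `[0,1]`. -/
def IsArc {E : Type*} [MetricSpace E] (Λ : Set E) : Prop :=
  ∃ h : unitInterval → E, IsArcParam Λ h

/-- `Λ` is a `t`-quasi-arc: `Λ` is an arc and there is `c > 0` with
`(diam Λ(x,y)) ^ t ≤ c * |x - y|` for all `x, y ∈ Λ`. For `x = h a` and `y = h b` the subarc
`Λ(x,y)` is the image of the interval between `a` and `b`; it does not depend on `h`. -/
def IsQuasiArc {E : Type*} [MetricSpace E] (t : ℝ) (Λ : Set E) : Prop :=
  ∃ h : unitInterval → E, IsArcParam Λ h ∧ ∃ c : ℝ, 0 < c ∧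
    ∀ a b : unitInterval, Metric.diam (h '' Set.uIcc a b) ^ t ≤ c * dist (h a) (h b)

/-- `Λ` is the (non-empty compact) self-similar set of the maps `S 1, …, S ℓ`. -/
structure IsSelfSimilarSet {E : Type*} [MetricSpace E] (ℓ : ℕ) (S : ℕ → E → E) (Λ : Set E) :
    Prop where
  isCompact : IsCompact Λ
  nonempty : Λ.Nonempty
  eq_iUnion : Λ = ⋃ j ∈ Set.Icc 1 ℓ, S j '' Λ

/-- `Λ` is a self-similar arc for the maps `S 1, …, S ℓ`. -/
structure IsSelfSimilarArc {E : Type*} [MetricSpace E] (ℓ : ℕ) (S : ℕ → E → E) (Λ : Set E) :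
    Prop extends IsSelfSimilarSet ℓ S Λ where
  isArc : IsArc Λ
  inter_succ : ∀ j, 1 ≤ j → j + 1 ≤ ℓ → ∃ z, S j '' Λ ∩ S (j + 1) '' Λ = {z}
  disjoint : ∀ i j, 1 ≤ i → i + 1 < j → j ≤ ℓ → Disjoint (S i '' Λ) (S j '' Λ)

/-- The argument of a complex number, normalized to lie in `[0, 2π)`. -/
def argPos (w : ℂ) : ℝ := toIcoMod Real.two_pi_pos 0 (Complex.arg w)

/-- A polygonal line in the plane with vertices `A 0, …, A ℓ` and a marked vertex `A q`
(the values `A j` for `j > ℓ` are never used). -/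
structure Polygon where
  ℓ : ℕ
  A : ℕ → ℂ
  q : ℕ

namespace Polygon

variable (P : Polygon)

/-- For `1 ≤ j ≤ ℓ`, the orientation preserving similitude with `A 0 ↦ A (j-1)`, `A ℓ ↦ A j`. -/
def S (j : ℕ) (z : ℂ) : ℂ :=
  P.A (j - 1) + (P.A j - P.A (j - 1)) / (P.A P.ℓ - P.A 0) * (z - P.A 0)

/-- The interior of the triangle with corners `A 0`, `A ℓ`, `A q`. -/
def openTriangle : Set ℂ := interior (convexHull ℝ {P.A 0, P.A P.ℓ, P.A P.q})

/-- The basic triangle: the closure of the open triangle. -/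
def triangle : Set ℂ := closure P.openTriangle

/-- The polygon is a basic figure, with the marked vertex to the left of the oriented base. -/
structure IsBasicFigure : Prop where
  q_pos : 0 < P.q
  q_lt : P.q < P.ℓ
  vertices_injOn : Set.InjOn P.A (Set.Iic P.ℓ)
  first_mem : P.A 1 ∈ segment ℝ (P.A 0) (P.A P.ℓ)
  last_mem : P.A (P.ℓ - 1) ∈ segment ℝ (P.A 0) (P.A P.ℓ)
  last_mem' : P.A (P.ℓ - 1) ∈ segment ℝ (P.A 1) (P.A P.ℓ)
  vertices_mem : ∀ j ≤ P.ℓ, P.A j ∈ {P.A P.q} ∪ segment ℝ (P.A 0) (P.A P.ℓ) ∪ P.openTriangle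
  contractive : ∀ j, 1 ≤ j → j ≤ P.ℓ → ‖(P.A j - P.A (j - 1)) / (P.A P.ℓ - P.A 0)‖ < 1
  disjoint : ∀ i j, 1 ≤ i → i < j → j ≤ P.ℓ →
    Disjoint (P.S i '' P.openTriangle) (P.S j '' P.openTriangle)
  apex_mem : ∀ j, 1 ≤ j → j ≤ P.ℓ → P.S j (P.A P.q) ∈ P.triangle
  sides : ∀ j, 1 ≤ j → j ≤ P.ℓ → j ≠ 1 → j ≠ P.ℓ → j ≠ P.q → j ≠ P.q + 1 →
    P.S j '' P.triangle ∩
      (segment ℝ (P.A P.q) (P.A 0) ∪ segment ℝ (P.A P.q) (P.A P.ℓ)) = ∅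
  orientation : 0 < ((P.A P.q - P.A 0) / (P.A P.ℓ - P.A 0)).im

/-- The corner angle at the vertex `A p`, for `1 ≤ p ≤ ℓ - 1`. -/
def theta (p : ℕ) : ℝ :=
  argPos ((P.S p (P.A P.q) - P.A p) / (P.S (p + 1) (P.A P.q) - P.A p))

/-- The minimal corner angle (the infimum of a finite set, non-empty as soon as `2 ≤ ℓ`). -/
def thetaMin : ℝ := sInf (P.theta '' Set.Icc 1 (P.ℓ - 1))

def eta₁ : ℝ := argPos ((P.S P.q (P.A P.q) - P.A P.q) / (P.A 0 - P.A P.q))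

def eta₂ : ℝ := argPos ((P.A P.ℓ - P.A P.q) / (P.S (P.q + 1) (P.A P.q) - P.A P.q))

/-- The characteristic angle. -/
def characteristicAngle : ℝ := P.thetaMin + min P.eta₁ P.eta₂

/-- `Λ` is the regular self-similar arc generated by `P`: `P` is a basic figure with positive
characteristic angle, and its self-similar set `Λ` is an arc. -/
structure GeneratesRegularArc (Λ : Set ℂ) : Prop where
  isBasicFigure : P.IsBasicFigure
  characteristicAngle_pos : 0 < P.characteristicAngle
  isSelfSimilarArc : IsSelfSimilarArc P.ℓ P.S Λ

end Polygon

end RegularArc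

end

namespace RegularArc

/-- The affine map of `[0, 1]` onto its `j`-th part, after division into `n` equal parts. -/
noncomputable def subpart (n j : ℕ) (s : unitInterval) : unitInterval :=
  Set.projIcc 0 1 zero_le_one (((j : ℝ) - 1 + s) / n)

theorem coe_subpart {n j : ℕ} (hj : 1 ≤ j) (hjn : j ≤ n) (s : unitInterval) :
    (subpart n j s : ℝ) = ((j : ℝ) - 1 + s) / n := by
  have h1 : (1 : ℝ) ≤ j := by exact_mod_cast hj
  have h2 : (j : ℝ) ≤ n := by exact_mod_cast hjn
  have hn : (0 : ℝ) < n := by linarith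
  have hs := s.2
  have : ((j : ℝ) - 1 + s) / n ∈ Set.Icc (0 : ℝ) 1 := by
    constructor
    · have := hs.1
      apply div_nonneg <;> linarith
    · rw [div_le_one hn]
      linarith [hs.2]
  rw [subpart, Set.projIcc_of_mem _ this]

theorem exists_subpart {n : ℕ} (hn : 0 < n) (x : unitInterval) :
    ∃ j, 1 ≤ j ∧ j ≤ n ∧ ∃ s, subpart n j s = x := by
  have hn' : (0 : ℝ) < n := by exact_mod_cast hn
  obtain ⟨x, hx0, hx1⟩ := x
  rcases hx0.eq_or_lt with rfl | hx0
  · refine ⟨1, le_rfl, hn, 0, Subtype.ext ?_⟩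
    rw [coe_subpart le_rfl hn]
    simp
  · have hpos : 0 < (n : ℝ) * x := by positivity
    have h1 : 1 ≤ ⌈(n : ℝ) * x⌉₊ := Nat.one_le_iff_ne_zero.2 (Nat.ceil_pos.2 hpos).ne'
    have h2 : ⌈(n : ℝ) * x⌉₊ ≤ n := Nat.ceil_le.2 (by nlinarith)
    refine ⟨⌈(n : ℝ) * x⌉₊, h1, h2, ⟨n * x - ⌈(n : ℝ) * x⌉₊ + 1, ?_, ?_⟩, Subtype.ext ?_⟩
    · linarith [Nat.ceil_lt_add_one hpos.le]
    · linarith [Nat.le_ceil ((n : ℝ) * x)]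
    · rw [coe_subpart h1 h2]
      field_simp
      ring

theorem subpart_one {n j : ℕ} (hj : 1 ≤ j) (hjn : j + 1 ≤ n) :
    subpart n j 1 = subpart n (j + 1) 0 := by
  apply Subtype.ext
  rw [coe_subpart hj (by omega), coe_subpart (by omega) hjn]
  push_cast
  simp

theorem subpart_first {n : ℕ} (hn : 1 ≤ n) : subpart n 1 0 = 0 := by
  apply Subtype.ext
  rw [coe_subpart le_rfl hn]
  simp

theorem subpart_last {n : ℕ} (hn : 1 ≤ n) : subpart n n 1 = 1 := by
  apply Subtype.ext
  rw [coe_subpart hn le_rfl]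
  have : (n : ℝ) ≠ 0 := by positivity
  simp [this]

namespace Polygon

variable (P : Polygon)

/-- The complex ratio of the similitude `P.S j`. -/
noncomputable def ratio (j : ℕ) : ℂ := (P.A j - P.A (j - 1)) / (P.A P.ℓ - P.A 0)

theorem S_eq (j : ℕ) (z : ℂ) : P.S j z = P.A (j - 1) + P.ratio j * (z - P.A 0) := rfl

theorem S_sub (j : ℕ) (z z' : ℂ) : P.S j z - P.S j z' = P.ratio j * (z - z') := by
  rw [S_eq, S_eq]; ring

theorem dist_S (j : ℕ) (z z' : ℂ) : dist (P.S j z) (P.S j z') = ‖P.ratio j‖ * dist z z' := by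
  rw [dist_eq_norm, S_sub, norm_mul, dist_eq_norm]

theorem S_first (j : ℕ) : P.S j (P.A 0) = P.A (j - 1) := by simp [S_eq]

variable {P}

theorem S_last (h : P.A P.ℓ ≠ P.A 0) (j : ℕ) : P.S j (P.A P.ℓ) = P.A j := by
  have : P.A P.ℓ - P.A 0 ≠ 0 := sub_ne_zero.2 h
  rw [S_eq, ratio, div_mul_cancel₀ _ this]; ring

/-- The curve `γ` is the parametrization of the self-similar set of `P` in which the `j`-th
part of `[0, 1]` is mapped to the `j`-th piece. -/
structure IsCurve (P : Polygon) (γ : unitInterval → ℂ) : Prop where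
  continuous : Continuous γ
  zero : γ 0 = P.A 0
  one : γ 1 = P.A P.ℓ
  map_subpart : ∀ j, 1 ≤ j → j ≤ P.ℓ → ∀ s, γ (subpart P.ℓ j s) = P.S j (γ s)

/-- The operator whose fixed point is the self-similar curve of `P`. -/
noncomputable def refineCurve (P : Polygon) (f : C(unitInterval, ℂ)) : C(unitInterval, ℂ) where
  toFun x := P.A 0 + ∑ i ∈ Finset.range P.ℓ,
    P.ratio (i + 1) * (f (Set.projIcc 0 1 zero_le_one ((P.ℓ : ℝ) * x - i)) - P.A 0)
  continuous_toFun := by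
    refine continuous_const.add (continuous_finsetSum _ fun i _ => continuous_const.mul ?_)
    refine (f.continuous.comp (continuous_projIcc.comp ?_)).sub continuous_const
    fun_prop

theorem refineCurve_subpart (h : P.A P.ℓ ≠ P.A 0) {f : C(unitInterval, ℂ)} (h0 : f 0 = P.A 0)
    (h1 : f 1 = P.A P.ℓ) {j : ℕ} (hj : 1 ≤ j) (hjl : j ≤ P.ℓ) (s : unitInterval) :
    P.refineCurve f (subpart P.ℓ j s) = P.S j (f s) := by
  have hA : P.A P.ℓ - P.A 0 ≠ 0 := sub_ne_zero.2 h
  have hl : (P.ℓ : ℝ) ≠ 0 := by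
    have : P.ℓ ≠ 0 := by omega
    exact_mod_cast this
  obtain ⟨k, rfl⟩ : ∃ k, j = k + 1 := ⟨j - 1, by omega⟩
  obtain ⟨d, hd⟩ : ∃ d, P.ℓ = k + 1 + d := ⟨P.ℓ - (k + 1), by omega⟩
  have hx : (P.ℓ : ℝ) * (subpart P.ℓ (k + 1) s : ℝ) = k + s := by
    rw [coe_subpart hj hjl]
    push_cast
    field_simp
    ring
  have hs := s.2
  change P.A 0 + ∑ i ∈ Finset.range P.ℓ, P.ratio (i + 1) * (f (Set.projIcc 0 1 zero_le_one
    ((P.ℓ : ℝ) * (subpart P.ℓ (k + 1) s : ℝ) - i)) - P.A 0) = _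
  simp_rw [hx]
  have hsum : ∑ i ∈ Finset.range P.ℓ, P.ratio (i + 1) *
      (f (Set.projIcc 0 1 zero_le_one ((k : ℝ) + s - i)) - P.A 0) =
      (P.A k - P.A 0) + P.ratio (k + 1) * (f s - P.A 0) := by
    rw [hd, Finset.sum_range_add, Finset.sum_range_succ]
    have e1 : ∑ i ∈ Finset.range k, P.ratio (i + 1) *
        (f (Set.projIcc 0 1 zero_le_one ((k : ℝ) + s - i)) - P.A 0) = P.A k - P.A 0 := by
      rw [← Finset.sum_range_sub]
      refine Finset.sum_congr rfl fun i hi => ?_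
      have hi' : (i : ℝ) + 1 ≤ k := by exact_mod_cast Finset.mem_range.1 hi
      rw [Set.projIcc_of_right_le _ (by linarith [hs.1])]
      have : (⟨1, Set.right_mem_Icc.2 zero_le_one⟩ : unitInterval) = 1 := rfl
      rw [this, h1, ratio, div_mul_cancel₀ _ hA]
      simp
    have e2 : Set.projIcc 0 1 zero_le_one ((k : ℝ) + s - k) = s := by
      rw [add_sub_cancel_left]
      exact Set.projIcc_val _ s
    have e3 : ∑ i ∈ Finset.range d, P.ratio (k + 1 + i + 1) *
        (f (Set.projIcc 0 1 zero_le_one ((k : ℝ) + s - (k + 1 + i : ℕ))) - P.A 0) = 0 := by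
      refine Finset.sum_eq_zero fun i _ => ?_
      rw [Set.projIcc_of_le_left _ (by push_cast; linarith [hs.2, Nat.cast_nonneg (α := ℝ) i])]
      have : (⟨0, Set.left_mem_Icc.2 zero_le_one⟩ : unitInterval) = 0 := rfl
      rw [this, h0]
      simp
    rw [e1, e2, e3, add_zero]
  rw [hsum, S_eq, add_tsub_cancel_right]
  ring

theorem exists_isCurve (hl : 0 < P.ℓ) (h : P.A P.ℓ ≠ P.A 0)
    (hc : ∀ j, 1 ≤ j → j ≤ P.ℓ → ‖P.ratio j‖ < 1) {K : Set ℂ} (hK : IsClosed K)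
    (hseg : segment ℝ (P.A 0) (P.A P.ℓ) ⊆ K)
    (hmaps : ∀ j, 1 ≤ j → j ≤ P.ℓ → Set.MapsTo (P.S j) K K) :
    ∃ γ : unitInterval → ℂ, IsCurve P γ ∧ ∀ s, γ s ∈ K := by
  obtain ⟨q, hq1, hq⟩ : ∃ q : NNReal, q < 1 ∧ ∀ j, 1 ≤ j → j ≤ P.ℓ → ‖P.ratio j‖₊ ≤ q := by
    refine ⟨(Finset.Icc 1 P.ℓ).sup fun j => ‖P.ratio j‖₊, ?_, fun j h1 h2 => ?_⟩
    · rw [Finset.sup_lt_iff (by simp)]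
      intro j hj
      rw [Finset.mem_Icc] at hj
      exact hc j hj.1 hj.2
    · exact Finset.le_sup (f := fun j => ‖P.ratio j‖₊) (Finset.mem_Icc.2 ⟨h1, h2⟩)
  set s : Set C(unitInterval, ℂ) := {f | f 0 = P.A 0 ∧ f 1 = P.A P.ℓ ∧ ∀ x, f x ∈ K} with hs
  have hsc : IsClosed s := by
    have e : s = {f | f 0 = P.A 0} ∩ ({f | f 1 = P.A P.ℓ} ∩ ⋂ x, {f | f x ∈ K}) := by
      ext f; simp [hs]
    rw [e]
    refine (isClosed_eq (by fun_prop) continuous_const).inter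
      ((isClosed_eq (by fun_prop) continuous_const).inter (isClosed_iInter fun x => ?_))
    exact hK.preimage (continuous_eval_const x)
  have hmap : Set.MapsTo P.refineCurve s s := by
    rintro f ⟨f0, f1, fK⟩
    refine ⟨?_, ?_, fun x => ?_⟩
    · have := refineCurve_subpart h f0 f1 le_rfl hl 0
      rwa [subpart_first hl, f0, S_first] at this
    · have := refineCurve_subpart h f0 f1 hl le_rfl 1
      rwa [subpart_last hl, f1, S_last h] at this
    · obtain ⟨j, hj, hjl, t, rfl⟩ := exists_subpart hl x
      rw [refineCurve_subpart h f0 f1 hj hjl]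
      exact hmaps j hj hjl (fK t)
  have hcontr : ContractingWith q (hmap.restrict P.refineCurve s s) := by
    refine ⟨hq1, LipschitzWith.of_dist_le_mul ?_⟩
    rintro ⟨f, f0, f1, fK⟩ ⟨g, g0, g1, gK⟩
    change dist (P.refineCurve f) (P.refineCurve g) ≤ q * dist f g
    rw [ContinuousMap.dist_le (by positivity)]
    intro x
    obtain ⟨j, hj, hjl, t, rfl⟩ := exists_subpart hl x
    rw [refineCurve_subpart h f0 f1 hj hjl, refineCurve_subpart h g0 g1 hj hjl, dist_S]
    exact mul_le_mul (hq j hj hjl) (ContinuousMap.dist_apply_le_dist t) dist_nonneg q.2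
  let f₀ : C(unitInterval, ℂ) :=
    ⟨fun x => AffineMap.lineMap (P.A 0) (P.A P.ℓ) (x : ℝ), by
      simp only [AffineMap.lineMap_apply]; fun_prop⟩
  have hf₀ : f₀ ∈ s := by
    refine ⟨by simp [f₀], by simp [f₀], fun x => hseg ?_⟩
    rw [segment_eq_image_lineMap]
    exact ⟨x, x.2, rfl⟩
  obtain ⟨f, hf, hfix, -⟩ := hcontr.exists_fixedPoint' hsc.isComplete hmap hf₀ (edist_ne_top _ _)
  refine ⟨f, ⟨f.continuous, hf.1, hf.2.1, fun j hj hjl t => ?_⟩, hf.2.2⟩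
  rw [← refineCurve_subpart h hf.1 hf.2.1 hj hjl, hfix]

end Polygon

end RegularArc

namespace RegularArc.Polygon

variable {P : Polygon} {γ : unitInterval → ℂ}

theorem ratio_ne_zero (hA : Set.InjOn P.A (Set.Iic P.ℓ)) {j : ℕ} (hj : 1 ≤ j) (hjl : j ≤ P.ℓ) :
    P.ratio j ≠ 0 := by
  refine div_ne_zero (sub_ne_zero.2 fun h => ?_) (sub_ne_zero.2 fun h => ?_)
  · have := hA (Set.mem_Iic.2 hjl) (Set.mem_Iic.2 (by omega)) h
    omega
  · have := hA (Set.mem_Iic.2 le_rfl) (Set.mem_Iic.2 (by omega)) h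
    omega

theorem S_injective (hA : Set.InjOn P.A (Set.Iic P.ℓ)) {j : ℕ} (hj : 1 ≤ j) (hjl : j ≤ P.ℓ) :
    Function.Injective (P.S j) := by
  intro z z' h
  have h' := S_sub P j z z'
  rw [h, sub_self, eq_comm, mul_eq_zero, sub_eq_zero] at h'
  exact h'.resolve_left (ratio_ne_zero hA hj hjl)

namespace IsCurve

theorem isSelfSimilarSet (hγ : IsCurve P γ) (hl : 0 < P.ℓ) :
    IsSelfSimilarSet P.ℓ P.S (Set.range γ) where
  isCompact := isCompact_range hγ.continuous
  nonempty := Set.range_nonempty γ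
  eq_iUnion := by
    ext z
    simp only [Set.mem_range, Set.mem_iUnion, Set.mem_image, Set.mem_Icc, exists_prop,
      exists_exists_eq_and]
    constructor
    · rintro ⟨x, rfl⟩
      obtain ⟨j, hj, hjl, s, rfl⟩ := exists_subpart hl x
      exact ⟨j, ⟨hj, hjl⟩, s, (hγ.map_subpart j hj hjl s).symm⟩
    · rintro ⟨j, ⟨hj, hjl⟩, s, rfl⟩
      exact ⟨_, hγ.map_subpart j hj hjl s⟩

theorem _root_.RegularArc.eq_of_forall_abs_le_pow {s t : unitInterval}
    (h : ∀ k : ℕ, |(t : ℝ) - s| ≤ (1 / 2) ^ k) : s = t := by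
  have : |(t : ℝ) - s| ≤ 0 := ge_of_tendsto'
    (tendsto_pow_atTop_nhds_zero_of_lt_one (by norm_num : (0 : ℝ) ≤ 1 / 2) (by norm_num)) h
  have := abs_nonpos_iff.1 this
  exact Subtype.ext (by linarith)

theorem _root_.RegularArc.abs_subpart_sub {n j : ℕ} (hn : 2 ≤ n) (hj : 1 ≤ j) (hjn : j ≤ n)
    (s t : unitInterval) :
    |(subpart n j t : ℝ) - subpart n j s| ≤ 1 / 2 * |(t : ℝ) - s| := by
  have h2 : (2 : ℝ) ≤ n := by exact_mod_cast hn
  rw [coe_subpart hj hjn, coe_subpart hj hjn,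
    show ((j : ℝ) - 1 + t) / n - ((j : ℝ) - 1 + s) / n = (1 / n) * (t - s) by ring, abs_mul]
  refine mul_le_mul_of_nonneg_right ?_ (abs_nonneg _)
  rw [abs_of_nonneg (by positivity)]
  exact one_div_le_one_div_of_le (by norm_num) h2

theorem _root_.RegularArc.abs_sub_le_one (s t : unitInterval) : |(t : ℝ) - s| ≤ 1 := by
  rw [abs_le]
  constructor <;> linarith [s.2.1, s.2.2, t.2.1, t.2.2]

theorem eq_zero_of_apply_eq
    (hγ : IsCurve P γ) (hl : 2 ≤ P.ℓ) (hA : Set.InjOn P.A (Set.Iic P.ℓ))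
    (hdis : ∀ i j, 1 ≤ i → i + 1 < j → j ≤ P.ℓ → ∀ s t, P.S i (γ s) ≠ P.S j (γ t))
    (hsucc : ∀ i, 1 ≤ i → i + 1 ≤ P.ℓ → ∀ s t,
      P.S i (γ s) = P.S (i + 1) (γ t) → P.S i (γ s) = P.A i)
    {s : unitInterval} (hs : γ s = P.A 0) : s = 0 := by
  refine (eq_of_forall_abs_le_pow fun k => ?_).symm
  induction k generalizing s with
  | zero => simpa using abs_sub_le_one 0 s
  | succ k ih =>
    obtain ⟨j, hj, hjl, t, rfl⟩ := exists_subpart (by omega : 0 < P.ℓ) s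
    have h1 : P.S 1 (γ 0) = P.A 0 := by rw [hγ.zero, S_first]
    rw [hγ.map_subpart j hj hjl] at hs
    rcases (by omega : j = 1 ∨ j = 2 ∨ 2 < j) with rfl | rfl | h
    · rw [← h1] at hs
      have ht := S_injective hA hj hjl hs
      rw [hγ.zero] at ht
      have := abs_subpart_sub hl hj hjl 0 t
      rw [subpart_first (by omega)] at this
      rw [pow_succ']
      exact this.trans (mul_le_mul_of_nonneg_left (ih ht) (by norm_num))
    · have := hsucc 1 le_rfl (by omega) 0 t (by rw [h1, hs])
      rw [h1] at this
      have := hA (Set.mem_Iic.2 (by omega)) (Set.mem_Iic.2 (by omega)) this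
      omega
    · exact absurd (h1.trans hs.symm) (hdis 1 j le_rfl h hjl 0 t)

theorem eq_one_of_apply_eq
    (hγ : IsCurve P γ) (hl : 2 ≤ P.ℓ) (hA : Set.InjOn P.A (Set.Iic P.ℓ))
    (hdis : ∀ i j, 1 ≤ i → i + 1 < j → j ≤ P.ℓ → ∀ s t, P.S i (γ s) ≠ P.S j (γ t))
    (hsucc : ∀ i, 1 ≤ i → i + 1 ≤ P.ℓ → ∀ s t,
      P.S i (γ s) = P.S (i + 1) (γ t) → P.S i (γ s) = P.A i)
    {s : unitInterval} (hs : γ s = P.A P.ℓ) : s = 1 := by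
  have hne : P.A P.ℓ ≠ P.A 0 := fun h => by
    have := hA (Set.mem_Iic.2 le_rfl) (Set.mem_Iic.2 (by omega)) h
    omega
  refine (eq_of_forall_abs_le_pow fun k => ?_).symm
  induction k generalizing s with
  | zero => simpa using abs_sub_le_one 1 s
  | succ k ih =>
    obtain ⟨j, hj, hjl, t, rfl⟩ := exists_subpart (by omega : 0 < P.ℓ) s
    have h1 : P.S P.ℓ (γ 1) = P.A P.ℓ := by rw [hγ.one, S_last hne]
    rw [hγ.map_subpart j hj hjl] at hs
    rcases (by omega : j = P.ℓ ∨ j + 1 = P.ℓ ∨ j + 1 < P.ℓ) with rfl | h | h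
    · rw [← h1] at hs
      have ht := S_injective hA hj hjl hs
      rw [hγ.one] at ht
      have := abs_subpart_sub hl hj hjl 1 t
      rw [subpart_last (by omega)] at this
      rw [pow_succ']
      exact this.trans (mul_le_mul_of_nonneg_left (ih ht) (by norm_num))
    · have := hsucc j hj h.le t 1 (by rw [h, h1, hs])
      rw [hs] at this
      have := hA (Set.mem_Iic.2 le_rfl) (Set.mem_Iic.2 (by omega)) this
      omega
    · exact absurd (hs.trans h1.symm) (hdis j P.ℓ hj h le_rfl t 1)

theorem injective
    (hγ : IsCurve P γ) (hl : 2 ≤ P.ℓ) (hA : Set.InjOn P.A (Set.Iic P.ℓ))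
    (hdis : ∀ i j, 1 ≤ i → i + 1 < j → j ≤ P.ℓ → ∀ s t, P.S i (γ s) ≠ P.S j (γ t))
    (hsucc : ∀ i, 1 ≤ i → i + 1 ≤ P.ℓ → ∀ s t,
      P.S i (γ s) = P.S (i + 1) (γ t) → P.S i (γ s) = P.A i) : Function.Injective γ := by
  have hne : P.A P.ℓ ≠ P.A 0 := fun h => by
    have := hA (Set.mem_Iic.2 le_rfl) (Set.mem_Iic.2 (by omega)) h
    omega
  have key : ∀ i j, 1 ≤ i → i < j → j ≤ P.ℓ → ∀ s t, P.S i (γ s) = P.S j (γ t) →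
      subpart P.ℓ i s = subpart P.ℓ j t := by
    intro i j hi hij hj s t h
    rcases (by omega : i + 1 = j ∨ i + 1 < j) with rfl | h'
    · have h1 := hsucc i hi hj s t h
      have hs : s = 1 := by
        apply eq_one_of_apply_eq hγ hl hA hdis hsucc
        apply S_injective hA hi (by omega : i ≤ P.ℓ)
        rw [h1, S_last hne]
      have ht : t = 0 := by
        apply eq_zero_of_apply_eq hγ hl hA hdis hsucc
        apply S_injective hA (by omega : 1 ≤ i + 1) hj
        rw [← h, h1, S_first, add_tsub_cancel_right]
      rw [hs, ht, subpart_one hi hj]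
    · exact absurd h (hdis i j hi h' hj s t)
  intro s t hst
  refine eq_of_forall_abs_le_pow fun k => ?_
  induction k generalizing s t with
  | zero => simpa using abs_sub_le_one s t
  | succ k ih =>
    obtain ⟨i, hi, hil, s, rfl⟩ := exists_subpart (by omega : 0 < P.ℓ) s
    obtain ⟨j, hj, hjl, t, rfl⟩ := exists_subpart (by omega : 0 < P.ℓ) t
    rw [hγ.map_subpart i hi hil, hγ.map_subpart j hj hjl] at hst
    rcases lt_trichotomy i j with h | rfl | h
    · rw [key i j hi h hjl s t hst, sub_self, abs_zero]
      positivity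
    · rw [pow_succ']
      exact (abs_subpart_sub hl hi hil s t).trans
        (mul_le_mul_of_nonneg_left (ih (S_injective hA hi hil hst)) (by norm_num))
    · rw [key j i hj h hil t s hst.symm, sub_self, abs_zero]
      positivity

theorem isSelfSimilarArc
    (hγ : IsCurve P γ) (hl : 2 ≤ P.ℓ) (hA : Set.InjOn P.A (Set.Iic P.ℓ))
    (hdis : ∀ i j, 1 ≤ i → i + 1 < j → j ≤ P.ℓ → ∀ s t, P.S i (γ s) ≠ P.S j (γ t))
    (hsucc : ∀ i, 1 ≤ i → i + 1 ≤ P.ℓ → ∀ s t,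
      P.S i (γ s) = P.S (i + 1) (γ t) → P.S i (γ s) = P.A i) :
    IsSelfSimilarArc P.ℓ P.S (Set.range γ) where
  toIsSelfSimilarSet := hγ.isSelfSimilarSet (by omega)
  isArc := ⟨γ, hγ.continuous, hγ.injective hl hA hdis hsucc, rfl⟩
  inter_succ j hj hjl := by
    have hne : P.A P.ℓ ≠ P.A 0 := fun h => by
      have := hA (Set.mem_Iic.2 le_rfl) (Set.mem_Iic.2 (by omega)) h
      omega
    refine ⟨P.A j, Set.eq_singleton_iff_unique_mem.2
      ⟨⟨⟨γ 1, ⟨1, rfl⟩, ?_⟩, ⟨γ 0, ⟨0, rfl⟩, ?_⟩⟩, ?_⟩⟩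
    · rw [hγ.one, S_last hne]
    · rw [hγ.zero, S_first, add_tsub_cancel_right]
    · rintro z ⟨⟨_, ⟨s, rfl⟩, rfl⟩, ⟨_, ⟨t, rfl⟩, h⟩⟩
      exact hsucc j hj hjl s t h.symm
  disjoint i j hi hij hj := by
    rw [Set.disjoint_left]
    rintro z ⟨_, ⟨s, rfl⟩, rfl⟩ ⟨_, ⟨t, rfl⟩, h⟩
    exact hdis i j hi hij hj s t h.symm

/-- In a quasi-arc the distance between two points controls their distance to the points
between them, whatever the parametrization. -/
theorem exists_rpow_dist_le (hγ : Continuous γ) (hinj : Function.Injective γ) {τ : ℝ}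
    (hτ : 0 ≤ τ) (h : IsQuasiArc τ (Set.range γ)) :
    ∃ c : ℝ, 0 < c ∧ ∀ s t u, u ∈ Set.uIcc s t →
      dist (γ s) (γ u) ^ τ ≤ c * dist (γ s) (γ t) := by
  obtain ⟨f, ⟨hf, -, hfr⟩, c, hc, hfc⟩ := h
  refine ⟨c, hc, fun s t u hu => ?_⟩
  obtain ⟨a, ha⟩ : γ s ∈ Set.range f := hfr ▸ ⟨s, rfl⟩
  obtain ⟨b, hb⟩ : γ t ∈ Set.range f := hfr ▸ ⟨t, rfl⟩
  have hcompact : IsCompact (f '' Set.uIcc a b) := (isCompact_uIcc).image hf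
  have hconn : IsPreconnected (γ ⁻¹' (f '' Set.uIcc a b)) := by
    refine ((isPreconnected_uIcc).image f hf.continuousOn).preimage_of_isClosedMap hinj
      hγ.isClosedMap ?_
    rw [← hfr]
    exact Set.image_subset_range _ _
  have hmem : u ∈ γ ⁻¹' (f '' Set.uIcc a b) := by
    refine hconn.ordConnected.uIcc_subset ?_ ?_ hu
    · exact ⟨a, Set.left_mem_uIcc, ha⟩
    · exact ⟨b, Set.right_mem_uIcc, hb⟩
  rw [← ha, ← hb]
  refine le_trans (Real.rpow_le_rpow dist_nonneg ?_ hτ) (hfc a b)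
  exact Metric.dist_le_diam_of_mem hcompact.isBounded ⟨a, Set.left_mem_uIcc, rfl⟩ hmem

end IsCurve

end RegularArc.Polygon

namespace RegularArc.Polygon.IsCurve

variable {P : Polygon} {γ : unitInterval → ℂ}

theorem _root_.RegularArc.sub_subpart {n j : ℕ} (hj : 1 ≤ j) (hjn : j ≤ n)
    (s t : unitInterval) :
    (subpart n j t : ℝ) - subpart n j s = ((t : ℝ) - s) / n := by
  rw [coe_subpart hj hjn, coe_subpart hj hjn]
  ring

theorem _root_.RegularArc.inv_le_sub_subpart {n i j : ℕ} (hi : 1 ≤ i) (hij : i + 1 < j)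
    (hj : j ≤ n) (s t : unitInterval) :
    1 / (n : ℝ) ≤ (subpart n j t : ℝ) - subpart n i s := by
  have h : (i : ℝ) + 1 + 1 ≤ j := by exact_mod_cast hij
  rw [coe_subpart (by omega) hj, coe_subpart hi (by omega), ← sub_div]
  apply div_le_div_of_nonneg_right _ (Nat.cast_nonneg n)
  linarith [t.2.1, s.2.2]

theorem _root_.RegularArc.subpart_le_subpart {n i j : ℕ} (hi : 1 ≤ i) (hij : i < j)
    (hj : j ≤ n) (s t : unitInterval) : subpart n i s ≤ subpart n j t := by
  have h : (i : ℝ) + 1 ≤ j := by exact_mod_cast hij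
  rw [← Subtype.coe_le_coe, coe_subpart (by omega) hj, coe_subpart hi (by omega)]
  apply div_le_div_of_nonneg_right _ (Nat.cast_nonneg n)
  linarith [t.2.1, s.2.2]

theorem _root_.RegularArc.subpart_le_subpart_iff {n j : ℕ} (hj : 1 ≤ j) (hjn : j ≤ n)
    {s t : unitInterval} : subpart n j s ≤ subpart n j t ↔ s ≤ t := by
  have h : (0 : ℝ) < n := by exact_mod_cast (by omega : 0 < n)
  rw [← Subtype.coe_le_coe, ← Subtype.coe_le_coe, ← sub_nonneg, sub_subpart hj hjn,
    le_div_iff₀ h, zero_mul, sub_nonneg]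

theorem _root_.RegularArc.exists_subpart_eq_of_mem_Icc {n j : ℕ} (hj : 1 ≤ j) (hjn : j ≤ n)
    {s t x : unitInterval} (hx : x ∈ Set.Icc (subpart n j s) (subpart n j t)) :
    ∃ u ∈ Set.Icc s t, subpart n j u = x := by
  have h : (0 : ℝ) < n := by exact_mod_cast (by omega : 0 < n)
  have h1 := Subtype.coe_le_coe.2 hx.1
  have h2 := Subtype.coe_le_coe.2 hx.2
  rw [coe_subpart hj hjn, div_le_iff₀ h] at h1
  rw [coe_subpart hj hjn, le_div_iff₀ h] at h2
  have hu : (x : ℝ) * n - j + 1 ∈ Set.Icc (0 : ℝ) 1 :=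
    ⟨by linarith [s.2.1], by linarith [t.2.2]⟩
  refine ⟨⟨_, hu⟩, ⟨?_, ?_⟩, Subtype.ext ?_⟩
  · rw [← Subtype.coe_le_coe]; simp only; linarith
  · rw [← Subtype.coe_le_coe]; simp only; linarith
  · rw [coe_subpart hj hjn]
    field_simp
    ring

theorem isBounded_image (hγ : Continuous γ) (s : Set unitInterval) :
    Bornology.IsBounded (γ '' s) :=
  (isCompact_range hγ).isBounded.subset (Set.image_subset_range _ _)

theorem diam_image_subpart_le (hγ : IsCurve P γ) {j : ℕ} (hj : 1 ≤ j) (hjl : j ≤ P.ℓ)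
    (s t : unitInterval) :
    Metric.diam (γ '' Set.Icc (subpart P.ℓ j s) (subpart P.ℓ j t)) ≤
      ‖P.ratio j‖ * Metric.diam (γ '' Set.Icc s t) := by
  refine Metric.diam_le_of_forall_dist_le
    (mul_nonneg (norm_nonneg _) Metric.diam_nonneg) ?_
  rintro _ ⟨x, hx, rfl⟩ _ ⟨y, hy, rfl⟩
  obtain ⟨u, hu, rfl⟩ := exists_subpart_eq_of_mem_Icc hj hjl hx
  obtain ⟨v, hv, rfl⟩ := exists_subpart_eq_of_mem_Icc hj hjl hy
  rw [hγ.map_subpart j hj hjl, hγ.map_subpart j hj hjl, dist_S]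
  exact mul_le_mul_of_nonneg_left (Metric.dist_le_diam_of_mem
    (isBounded_image hγ.continuous _) ⟨u, hu, rfl⟩ ⟨v, hv, rfl⟩) (norm_nonneg _)

/-- Parameters a definite distance apart correspond to points a definite distance apart. -/
theorem exists_le_dist (hγ : Continuous γ) (hinj : Function.Injective γ) {ε : ℝ}
    (hε : 0 < ε) :
    ∃ d : ℝ, 0 < d ∧ ∀ s t : unitInterval, ε ≤ (t : ℝ) - s → d ≤ dist (γ s) (γ t) := by
  set Z : Set (unitInterval × unitInterval) := {p | ε ≤ (p.2 : ℝ) - p.1} with hZ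
  have hZc : IsCompact Z := (isClosed_le continuous_const (by fun_prop)).isCompact
  rcases Z.eq_empty_or_nonempty with h | h
  · refine ⟨1, one_pos, fun s t hst => ?_⟩
    have : (s, t) ∈ Z := hst
    simp [h] at this
  · obtain ⟨p, hp, hmin⟩ := hZc.exists_isMinOn h
      (f := fun p => dist (γ p.1) (γ p.2)) (by fun_prop)
    refine ⟨dist (γ p.1) (γ p.2), dist_pos.2 fun h => ?_, fun s t hst => ?_⟩
    · have h1 := hinj h
      have h2 : ε ≤ (p.2 : ℝ) - p.1 := hp
      rw [h1, sub_self] at h2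
      linarith
    · exact isMinOn_iff.1 hmin (s, t) hst

/-- As the ratios are at most one, a bound on pairs of points of
different pieces carries over to all pairs. -/
theorem rpow_diam_le_of_subpart (hγ : IsCurve P γ) (hl : 2 ≤ P.ℓ)
    (hc : ∀ j, 1 ≤ j → j ≤ P.ℓ → ‖P.ratio j‖ ≤ 1) {τ : ℝ} (hτ : 1 ≤ τ) {C : ℝ}
    (hC : ∀ i j, 1 ≤ i → i < j → j ≤ P.ℓ → ∀ s t,
      Metric.diam (γ '' Set.Icc (subpart P.ℓ i s) (subpart P.ℓ j t)) ^ τ ≤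
        C * dist (P.S i (γ s)) (P.S j (γ t))) {s t : unitInterval} (hst : s < t) :
    Metric.diam (γ '' Set.Icc s t) ^ τ ≤ C * dist (γ s) (γ t) := by
  have hpos : (0 : ℝ) < (t : ℝ) - s := sub_pos.2 hst
  obtain ⟨k, hk⟩ := exists_pow_lt_of_lt_one hpos (by norm_num : (1 / 2 : ℝ) < 1)
  clear hpos
  induction k generalizing s t with
  | zero =>
    rw [pow_zero] at hk
    linarith [s.2.1, t.2.2]
  | succ k ih =>
    obtain ⟨i, hi, hil, s, rfl⟩ := exists_subpart (by omega : 0 < P.ℓ) s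
    obtain ⟨j, hj, hjl, t, rfl⟩ := exists_subpart (by omega : 0 < P.ℓ) t
    rcases lt_trichotomy i j with h | rfl | h
    · rw [hγ.map_subpart i hi hil, hγ.map_subpart j hj hjl]
      exact hC i j hi h hjl s t
    · have hlt : s < t := lt_of_not_ge fun h =>
        absurd ((subpart_le_subpart_iff hi hil).2 h) (not_le.2 hst)
      have h1 := abs_subpart_sub hl hi hil s t
      rw [abs_of_pos (sub_pos.2 (Subtype.coe_lt_coe.2 hst)),
        abs_of_pos (sub_pos.2 (Subtype.coe_lt_coe.2 hlt))] at h1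
      rw [pow_succ'] at hk
      have h2 := ih hlt (by linarith)
      rw [hγ.map_subpart i hi hil, hγ.map_subpart i hi hil, dist_S]
      have h0 := norm_nonneg (P.ratio i)
      calc _ ≤ (‖P.ratio i‖ * Metric.diam (γ '' Set.Icc s t)) ^ τ :=
            Real.rpow_le_rpow Metric.diam_nonneg (diam_image_subpart_le hγ hi hil s t)
              (by linarith)
        _ = ‖P.ratio i‖ ^ τ * Metric.diam (γ '' Set.Icc s t) ^ τ :=
            Real.mul_rpow h0 Metric.diam_nonneg
        _ ≤ ‖P.ratio i‖ * (C * dist (γ s) (γ t)) := by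
            refine mul_le_mul ?_ h2 (Real.rpow_nonneg Metric.diam_nonneg _) h0
            exact Real.rpow_le_self_of_le_one h0 (hc i hi hil) hτ
        _ = _ := by ring
    · exact absurd (subpart_le_subpart hj h hil t s) (not_le.2 hst)

theorem exists_diam_initial_le
    (hγ : IsCurve P γ) (hinj : Function.Injective γ) (hl : 2 ≤ P.ℓ) :
    ∃ C : ℝ, 0 < C ∧ ∀ t, Metric.diam (γ '' Set.Icc 0 t) ≤ C * dist (γ 0) (γ t) := by
  have hn : (0 : ℝ) < P.ℓ := by exact_mod_cast (by omega : 0 < P.ℓ)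
  obtain ⟨d, hd, hdist⟩ := exists_le_dist hγ.continuous hinj (one_div_pos.2 hn)
  refine ⟨(Metric.diam (Set.range γ) + 1) / d, by positivity, fun t => ?_⟩
  rcases (unitInterval.nonneg' : 0 ≤ t).eq_or_lt with rfl | h
  · simp
  obtain ⟨k, hk⟩ := exists_pow_lt_of_lt_one (show (0 : ℝ) < t from h)
    (by norm_num : (1 / 2 : ℝ) < 1)
  clear h
  induction k generalizing t with
  | zero =>
    rw [pow_zero] at hk
    linarith [t.2.2]
  | succ k ih =>
    obtain ⟨j, hj, hjl, t, rfl⟩ := exists_subpart (by omega : 0 < P.ℓ) t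
    rcases (by omega : 1 = j ∨ 1 < j) with rfl | h
    · have h1 := abs_subpart_sub hl hj hjl 0 t
      rw [subpart_first (by omega), Set.Icc.coe_zero, sub_zero, sub_zero,
        abs_of_nonneg (subpart P.ℓ 1 t).2.1, abs_of_nonneg t.2.1] at h1
      rw [pow_succ'] at hk
      have h2 := ih t (by linarith)
      have h3 := diam_image_subpart_le hγ hj hjl 0 t
      have h4 := hγ.map_subpart 1 hj hjl 0
      rw [subpart_first (by omega)] at h3 h4
      rw [hγ.map_subpart 1 hj hjl, h4, dist_S]
      nlinarith [mul_le_mul_of_nonneg_left h2 (norm_nonneg (P.ratio 1))]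
    · have h1 : 1 / (P.ℓ : ℝ) ≤ (subpart P.ℓ j t : ℝ) - (0 : unitInterval) := by
        have h2 : (2 : ℝ) ≤ j := by exact_mod_cast h
        rw [coe_subpart hj hjl, Set.Icc.coe_zero, sub_zero]
        apply div_le_div_of_nonneg_right _ hn.le
        linarith [t.2.1]
      have h2 := hdist _ _ h1
      have h3 := Metric.diam_mono (Set.image_subset_range γ (Set.Icc 0 (subpart P.ℓ j t)))
        (isCompact_range hγ.continuous).isBounded
      rw [div_mul_eq_mul_div, le_div_iff₀ hd]
      have := Metric.diam_nonneg (s := Set.range γ)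
      nlinarith

theorem exists_diam_terminal_le
    (hγ : IsCurve P γ) (hinj : Function.Injective γ) (hl : 2 ≤ P.ℓ) :
    ∃ C : ℝ, 0 < C ∧ ∀ t, Metric.diam (γ '' Set.Icc t 1) ≤ C * dist (γ t) (γ 1) := by
  have hn : (0 : ℝ) < P.ℓ := by exact_mod_cast (by omega : 0 < P.ℓ)
  obtain ⟨d, hd, hdist⟩ := exists_le_dist hγ.continuous hinj (one_div_pos.2 hn)
  refine ⟨(Metric.diam (Set.range γ) + 1) / d, by positivity, fun t => ?_⟩
  rcases (unitInterval.le_one' : t ≤ 1).eq_or_lt with rfl | h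
  · simp
  obtain ⟨k, hk⟩ := exists_pow_lt_of_lt_one (sub_pos.2 (show (t : ℝ) < 1 from h))
    (by norm_num : (1 / 2 : ℝ) < 1)
  clear h
  induction k generalizing t with
  | zero =>
    rw [pow_zero] at hk
    linarith [t.2.1]
  | succ k ih =>
    obtain ⟨j, hj, hjl, t, rfl⟩ := exists_subpart (by omega : 0 < P.ℓ) t
    rcases (by omega : j = P.ℓ ∨ j + 1 ≤ P.ℓ) with h | h
    · rw [h] at hk ⊢
      have h1 := abs_subpart_sub hl (by omega) le_rfl t 1
      rw [subpart_last (by omega), Set.Icc.coe_one,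
        abs_of_nonneg (sub_nonneg.2 (subpart P.ℓ P.ℓ t).2.2),
        abs_of_nonneg (sub_nonneg.2 t.2.2)] at h1
      rw [pow_succ'] at hk
      have h2 := ih t (by linarith)
      have h3 := diam_image_subpart_le hγ (by omega) le_rfl t 1
      have h4 := hγ.map_subpart P.ℓ (by omega) le_rfl 1
      rw [subpart_last (by omega)] at h3 h4
      rw [hγ.map_subpart P.ℓ (by omega) le_rfl, h4, dist_S]
      nlinarith [mul_le_mul_of_nonneg_left h2 (norm_nonneg (P.ratio P.ℓ))]
    · have h1 : 1 / (P.ℓ : ℝ) ≤ ((1 : unitInterval) : ℝ) - subpart P.ℓ j t := by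
        have h2 : (j : ℝ) + 1 ≤ P.ℓ := by exact_mod_cast h
        rw [coe_subpart hj hjl, Set.Icc.coe_one, div_le_iff₀ hn, sub_mul,
          div_mul_cancel₀ _ hn.ne']
        linarith [t.2.2]
      have h2 := hdist _ _ h1
      have h3 := Metric.diam_mono (Set.image_subset_range γ (Set.Icc (subpart P.ℓ j t) 1))
        (isCompact_range hγ.continuous).isBounded
      rw [div_mul_eq_mul_div, le_div_iff₀ hd]
      have := Metric.diam_nonneg (s := Set.range γ)
      nlinarith

/-- The self-similar arc is a quasi-arc as soon as the pairs of points in adjacent pieces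
satisfy the corresponding bound. -/
theorem isQuasiArc
    (hγ : IsCurve P γ) (hinj : Function.Injective γ) (hl : 2 ≤ P.ℓ) (hne : P.A P.ℓ ≠ P.A 0)
    (hc : ∀ j, 1 ≤ j → j ≤ P.ℓ → ‖P.ratio j‖ ≤ 1) {τ : ℝ} (hτ : 1 ≤ τ)
    (h : ∀ i, 1 ≤ i → i + 1 ≤ P.ℓ → ∃ C, ∀ s t,
      (dist (P.S i (γ s)) (P.A i) + dist (P.A i) (P.S (i + 1) (γ t))) ^ τ ≤
        C * dist (P.S i (γ s)) (P.S (i + 1) (γ t))) :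
    IsQuasiArc τ (Set.range γ) := by
  have hn : (0 : ℝ) < P.ℓ := by exact_mod_cast (by omega : 0 < P.ℓ)
  have hτ0 : 0 ≤ τ := by linarith
  obtain ⟨d, hd, hdist⟩ := exists_le_dist hγ.continuous hinj (one_div_pos.2 hn)
  obtain ⟨C₀, hC₀, hfirst⟩ := exists_diam_initial_le hγ hinj hl
  obtain ⟨C₁, hC₁, hterm⟩ := exists_diam_terminal_le hγ hinj hl
  choose! C hC using h
  set M := Metric.diam (Set.range γ) with hM
  have hM0 : 0 ≤ M := Metric.diam_nonneg
  set K := (C₀ + C₁) ^ τ * (∑ i ∈ Finset.range P.ℓ, |C i|) + (M + 1) ^ τ / d with hK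
  have hKpos : 0 < K := by
    have : 0 ≤ ∑ i ∈ Finset.range P.ℓ, |C i| := Finset.sum_nonneg fun _ _ => abs_nonneg _
    positivity
  have hpair : ∀ i j, 1 ≤ i → i < j → j ≤ P.ℓ → ∀ s t,
      Metric.diam (γ '' Set.Icc (subpart P.ℓ i s) (subpart P.ℓ j t)) ^ τ ≤
        K * dist (P.S i (γ s)) (P.S j (γ t)) := by
    intro i j hi hij hj s t
    have hsum0 : 0 ≤ ∑ i ∈ Finset.range P.ℓ, |C i| := Finset.sum_nonneg fun _ _ => abs_nonneg _
    rcases (by omega : i + 1 = j ∨ i + 1 < j) with rfl | hij'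
    · have hdiam : Metric.diam (γ '' Set.Icc (subpart P.ℓ i s) (subpart P.ℓ (i + 1) t)) ≤
          (C₀ + C₁) * (dist (P.S i (γ s)) (P.A i) + dist (P.A i) (P.S (i + 1) (γ t))) := by
        have e1 := diam_image_subpart_le hγ hi (by omega) s 1
        have e2 := diam_image_subpart_le hγ (by omega) hj 0 t
        have e3 : dist (P.S i (γ s)) (P.A i) = ‖P.ratio i‖ * dist (γ s) (γ 1) := by
          rw [← dist_S, hγ.one, S_last hne]
        have e4 : dist (P.A i) (P.S (i + 1) (γ t)) = ‖P.ratio (i + 1)‖ * dist (γ 0) (γ t) := by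
          rw [← dist_S, hγ.zero, S_first, add_tsub_cancel_right]
        have hsub : γ '' Set.Icc (subpart P.ℓ i s) (subpart P.ℓ (i + 1) t) ⊆
            γ '' Set.Icc (subpart P.ℓ i s) (subpart P.ℓ i 1) ∪
            γ '' Set.Icc (subpart P.ℓ (i + 1) 0) (subpart P.ℓ (i + 1) t) := by
          rw [← Set.image_union]
          refine Set.image_mono ?_
          rw [← subpart_one hi hj]
          exact Set.Icc_subset_Icc_union_Icc
        have hinter : (γ '' Set.Icc (subpart P.ℓ i s) (subpart P.ℓ i 1) ∩
            γ '' Set.Icc (subpart P.ℓ (i + 1) 0) (subpart P.ℓ (i + 1) t)).Nonempty := by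
          refine ⟨γ (subpart P.ℓ i 1), ⟨_, ⟨?_, le_rfl⟩, rfl⟩, ⟨subpart P.ℓ (i + 1) 0,
            ⟨le_rfl, ?_⟩, ?_⟩⟩
          · exact (subpart_le_subpart_iff hi (by omega)).2 le_top
          · exact (subpart_le_subpart_iff (by omega) hj).2 bot_le
          · rw [subpart_one hi hj]
        have e5 := (Metric.diam_mono hsub ((isBounded_image hγ.continuous _).union
          (isBounded_image hγ.continuous _))).trans (Metric.diam_union' hinter)
        have e6 := mul_le_mul_of_nonneg_left (hterm s) (norm_nonneg (P.ratio i))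
        have e7 := mul_le_mul_of_nonneg_left (hfirst t) (norm_nonneg (P.ratio (i + 1)))
        have e8 := dist_nonneg (x := P.S i (γ s)) (y := P.A i)
        have e9 := dist_nonneg (x := P.A i) (y := P.S (i + 1) (γ t))
        rw [e3] at e8 ⊢
        rw [e4] at e9 ⊢
        nlinarith [mul_nonneg hC₀.le e8, mul_nonneg hC₁.le e9]
      have hCi : C i ≤ ∑ i ∈ Finset.range P.ℓ, |C i| :=
        (le_abs_self _).trans (Finset.single_le_sum (f := fun i => |C i|)
          (fun _ _ => abs_nonneg _) (Finset.mem_range.2 (by omega)))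
      have hdd := dist_nonneg (x := P.S i (γ s)) (y := P.S (i + 1) (γ t))
      calc _ ≤ ((C₀ + C₁) * (dist (P.S i (γ s)) (P.A i) +
              dist (P.A i) (P.S (i + 1) (γ t)))) ^ τ :=
            Real.rpow_le_rpow Metric.diam_nonneg hdiam hτ0
        _ = (C₀ + C₁) ^ τ * (dist (P.S i (γ s)) (P.A i) +
              dist (P.A i) (P.S (i + 1) (γ t))) ^ τ :=
            Real.mul_rpow (by positivity) (by positivity)
        _ ≤ (C₀ + C₁) ^ τ * ((∑ i ∈ Finset.range P.ℓ, |C i|) *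
              dist (P.S i (γ s)) (P.S (i + 1) (γ t))) := by
            refine mul_le_mul_of_nonneg_left ?_ (by positivity)
            exact (hC i hi hj s t).trans (mul_le_mul_of_nonneg_right hCi hdd)
        _ ≤ _ := by
            rw [← mul_assoc]
            refine mul_le_mul_of_nonneg_right ?_ hdd
            rw [hK]
            have : 0 ≤ (M + 1) ^ τ / d := by positivity
            linarith
    · have h1 := hdist _ _ (inv_le_sub_subpart hi hij' hj s t)
      rw [hγ.map_subpart i hi (by omega), hγ.map_subpart j (by omega) hj] at h1
      calc _ ≤ (M + 1) ^ τ := by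
            refine Real.rpow_le_rpow Metric.diam_nonneg ?_ hτ0
            have := Metric.diam_mono (Set.image_subset_range γ
              (Set.Icc (subpart P.ℓ i s) (subpart P.ℓ j t)))
              (isCompact_range hγ.continuous).isBounded
            linarith
        _ = (M + 1) ^ τ / d * d := by field_simp
        _ ≤ K * dist (P.S i (γ s)) (P.S j (γ t)) := by
            refine mul_le_mul ?_ h1 hd.le hKpos.le
            have : 0 ≤ (C₀ + C₁) ^ τ * (∑ i ∈ Finset.range P.ℓ, |C i|) := by positivity
            linarith
  refine ⟨γ, ⟨hγ.continuous, hinj, rfl⟩, K, hKpos, fun a b => ?_⟩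
  rcases lt_trichotomy a b with hab | rfl | hab
  · rw [Set.uIcc_of_le hab.le]
    exact rpow_diam_le_of_subpart hγ hl hc hτ hpair hab
  · rw [Set.uIcc_self, Set.image_singleton, Metric.diam_singleton, dist_self, mul_zero,
      Real.zero_rpow (by linarith)]
  · rw [Set.uIcc_of_ge hab.le, dist_comm]
    exact rpow_diam_le_of_subpart hγ hl hc hτ hpair hab

end RegularArc.Polygon.IsCurve

namespace RegularArc

/-- `α` is approximated from below by the fractions `p k / 2 ^ a k` with odd numerators, and the
error of each of them is comparable with the denominator of the next one. -/
structure IsDyadicApprox (α : ℝ) (a p : ℕ → ℕ) : Prop where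
  three_le : 3 ≤ a 0
  growth : ∀ k, 2 * a k + 1 ≤ a (k + 1)
  odd : ∀ k, Odd (p k)
  pow_le : ∀ k, 2 ^ a k ≤ p k
  le : ∀ k, (p k : ℝ) / 2 ^ a k ≤ α
  le_add : ∀ k, α ≤ (p k : ℝ) / 2 ^ a k + 2 / 2 ^ a (k + 1)
  one_lt : 1 < α
  le_five_fourths : α ≤ 5 / 4

/-- Each denominator may be prescribed as a function of the preceding fraction. -/
theorem exists_isDyadicApprox (F : ℕ → ℕ → ℕ) {a₀ : ℕ} (ha₀ : 3 ≤ a₀)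
    (hF : ∀ a p, a₀ ≤ a → 2 ^ a ≤ p → 2 * a + 1 ≤ F a p) :
    ∃ α a p, IsDyadicApprox α a p ∧ ∀ k, a (k + 1) = F (a k) (p k) := by
  let g : ℕ → ℕ × ℕ := fun k => Nat.rec (a₀, 2 ^ a₀ + 1)
    (fun _ x => (F x.1 x.2, x.2 * 2 ^ (F x.1 x.2 - x.1) + 1)) k
  set a : ℕ → ℕ := fun k => (g k).1 with ha
  set p : ℕ → ℕ := fun k => (g k).2 with hp
  have a_succ : ∀ k, a (k + 1) = F (a k) (p k) := fun k => rfl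
  have p_succ : ∀ k, p (k + 1) = p k * 2 ^ (a (k + 1) - a k) + 1 := fun k => rfl
  have inv : ∀ k, a₀ ≤ a k ∧ 2 ^ a k ≤ p k := by
    intro k
    induction k with
    | zero => exact ⟨le_rfl, Nat.le_succ _⟩
    | succ k ih =>
      have h := hF _ _ ih.1 ih.2
      rw [← a_succ] at h
      refine ⟨by omega, ?_⟩
      rw [p_succ]
      calc 2 ^ a (k + 1) = 2 ^ a k * 2 ^ (a (k + 1) - a k) := by
            rw [← pow_add]; congr 1; omega
        _ ≤ p k * 2 ^ (a (k + 1) - a k) := Nat.mul_le_mul_right _ ih.2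
        _ ≤ _ := Nat.le_succ _
  have growth : ∀ k, 2 * a k + 1 ≤ a (k + 1) := fun k => hF _ _ (inv k).1 (inv k).2
  have odd : ∀ k, Odd (p k) := by
    intro k
    cases k with
    | zero =>
      have : Even (2 ^ a₀) := (Nat.even_pow.2 ⟨even_two, by omega⟩)
      exact this.add_one
    | succ k =>
      rw [p_succ]
      have : Even (2 ^ (a (k + 1) - a k)) :=
        Nat.even_pow.2 ⟨even_two, by have := growth k; omega⟩
      exact (this.mul_left _).add_one
  set x : ℕ → ℝ := fun k => (p k : ℝ) / 2 ^ a k with hx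
  have x_succ : ∀ k, x (k + 1) = x k + 1 / 2 ^ a (k + 1) := by
    intro k
    have h : (2 : ℝ) ^ a (k + 1) = 2 ^ a k * 2 ^ (a (k + 1) - a k) := by
      rw [← pow_add]; congr 1; have := growth k; omega
    simp only [hx]
    rw [p_succ, h]
    push_cast
    field_simp
  have hmono : Monotone x := monotone_nat_of_le_succ fun k => by
    rw [x_succ]; exact le_add_of_nonneg_right (by positivity)
  have hanti : Antitone fun k => x k + 2 / 2 ^ a (k + 1) := antitone_nat_of_succ_le fun k => by
    rw [x_succ]
    have h : (2 : ℝ) / 2 ^ a (k + 1 + 1) ≤ 1 / 2 ^ a (k + 1) := by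
      rw [div_le_div_iff₀ (by positivity) (by positivity), one_mul, ← pow_succ']
      exact pow_le_pow_right₀ (by norm_num) (by have := growth (k + 1); omega)
    have e : (2 : ℝ) / 2 ^ a (k + 1) = 1 / 2 ^ a (k + 1) + 1 / 2 ^ a (k + 1) := by ring
    linarith
  have hle : x ≤ fun k => x k + 2 / 2 ^ a (k + 1) := fun k =>
    le_add_of_nonneg_right (by positivity)
  have hα := Set.mem_iInter.1 (hmono.ciSup_mem_iInter_Icc_of_antitone hanti hle)
  have x0 : x 0 = 1 + 1 / 2 ^ a₀ := by
    have : p 0 = 2 ^ a₀ + 1 := rfl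
    have h' : a 0 = a₀ := rfl
    simp only [hx, this, h']
    push_cast
    field_simp
  have h8 : (1 : ℝ) / 2 ^ a₀ ≤ 1 / 8 := by
    apply one_div_le_one_div_of_le (by norm_num)
    calc (8 : ℝ) = 2 ^ 3 := by norm_num
      _ ≤ 2 ^ a₀ := pow_le_pow_right₀ (by norm_num) ha₀
  have h9 : (2 : ℝ) / 2 ^ a 1 ≤ 1 / 8 := by
    rw [div_le_div_iff₀ (by positivity) (by norm_num)]
    calc (2 : ℝ) * 8 = 2 ^ 4 := by norm_num
      _ ≤ 2 ^ a 1 := pow_le_pow_right₀ (by norm_num) (by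
        have := growth 0; have := (inv 0).1; simp only [zero_add] at *; omega)
      _ = _ := by ring
  refine ⟨⨆ k, x k, a, p, ⟨ha₀, growth, odd, fun k => (inv k).2, fun k => (hα k).1,
    fun k => (hα k).2, ?_, ?_⟩, a_succ⟩
  · refine lt_of_lt_of_le ?_ (hα 0).1
    rw [x0]
    exact lt_add_of_pos_right _ (by positivity)
  · refine (hα 0).2.trans ?_
    simp only [zero_add]
    linarith

namespace IsDyadicApprox

variable {α : ℝ} {a p : ℕ → ℕ}

theorem self_le (h : IsDyadicApprox α a p) (k : ℕ) : k + 3 ≤ a k := by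
  induction k with
  | zero => simpa using h.three_le
  | succ k ih => have := h.growth k; omega

theorem tendsto_exponent (h : IsDyadicApprox α a p) : Filter.Tendsto a Filter.atTop Filter.atTop :=
  Filter.tendsto_atTop_mono (fun k => (by have := h.self_le k; omega : k ≤ a k)) Filter.tendsto_id

theorem tendsto_numerator (h : IsDyadicApprox α a p) : Filter.Tendsto (fun k =>
    (p k : ℝ)) Filter.atTop Filter.atTop :=
  tendsto_natCast_atTop_atTop.comp (Filter.tendsto_atTop_mono (fun k =>
    (Nat.lt_two_pow_self.le.trans (h.pow_le k))) h.tendsto_exponent)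

/-- Multiples of `α` by small numbers keep away from the half-integers. -/
theorem le_abs_sub (h : IsDyadicApprox α a p) (k m n : ℕ) (hm : m < 2 ^ (a (k + 1) - 1)) :
    1 / 2 ^ (a (k + 1) + 1) ≤ |α * m - (n + 1 / 2)| := by
  obtain ⟨b, hb⟩ : ∃ b, a (k + 1) = b + 1 := ⟨a (k + 1) - 1, by have := h.growth k; omega⟩
  rw [hb, Nat.add_sub_cancel] at hm
  have hne : (p (k + 1) : ℤ) * m - (2 * n + 1) * 2 ^ b ≠ 0 := by
    intro h0
    have h1 : p (k + 1) * m = (2 * n + 1) * 2 ^ b := by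
      exact_mod_cast sub_eq_zero.1 h0
    have h2 : 2 ^ b ∣ p (k + 1) * m := h1 ▸ Dvd.intro_left _ rfl
    have h3 : 2 ^ b ∣ m :=
      (Nat.Coprime.pow_left _ (Nat.coprime_two_left.2 (h.odd (k + 1)))).dvd_of_dvd_mul_left h2
    have h4 : 0 < m := Nat.pos_of_ne_zero fun h0 => by
      rw [h0, mul_zero] at h1
      have : 0 < (2 * n + 1) * 2 ^ b := by positivity
      omega
    exact absurd (Nat.le_of_dvd h4 h3) (not_le.2 hm)
  have h1 : (1 : ℝ) ≤ |(p (k + 1) : ℝ) * m - (2 * n + 1) * 2 ^ b| := by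
    exact_mod_cast Int.one_le_abs hne
  have h2 : 1 / 2 ^ (b + 1) ≤ |(p (k + 1) : ℝ) / 2 ^ (b + 1) * m - (n + 1 / 2)| := by
    have e : (p (k + 1) : ℝ) / 2 ^ (b + 1) * m - (n + 1 / 2) =
        ((p (k + 1) : ℝ) * m - (2 * n + 1) * 2 ^ b) / 2 ^ (b + 1) := by
      rw [pow_succ]; field_simp
    rw [e, abs_div, abs_of_pos (by positivity : (0 : ℝ) < 2 ^ (b + 1))]
    exact div_le_div_of_nonneg_right h1 (by positivity)
  have h3 : |(α - (p (k + 1) : ℝ) / 2 ^ (b + 1)) * m| ≤ 1 / 2 ^ (b + 2) := by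
    have g1 := h.le (k + 1)
    have g2 := h.le_add (k + 1)
    rw [hb] at g1 g2
    have hm' : (m : ℝ) ≤ 2 ^ b := by exact_mod_cast hm.le
    rw [abs_of_nonneg (mul_nonneg (sub_nonneg.2 g1) (Nat.cast_nonneg m))]
    calc _ ≤ 2 / 2 ^ a (k + 1 + 1) * 2 ^ b :=
          mul_le_mul (by linarith) hm' (Nat.cast_nonneg m) (by positivity)
      _ ≤ 2 / 2 ^ (2 * (b + 1) + 1) * 2 ^ b := by
          refine mul_le_mul_of_nonneg_right ?_ (by positivity)
          refine div_le_div_of_nonneg_left (by norm_num) (by positivity) ?_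
          exact pow_le_pow_right₀ (by norm_num) (by have := h.growth (k + 1); omega)
      _ = 1 / 2 ^ (b + 2) := by
          rw [show 2 * (b + 1) + 1 = (b + 2) + b + 1 by ring, pow_succ, pow_add _ (b + 2)]
          field_simp
  have h4 := abs_sub_abs_le_abs_sub ((p (k + 1) : ℝ) / 2 ^ (b + 1) * m - (n + 1 / 2))
    (-((α - (p (k + 1) : ℝ) / 2 ^ (b + 1)) * m))
  rw [abs_neg] at h4
  have e : α * m - (n + 1 / 2) = (p (k + 1) : ℝ) / 2 ^ (b + 1) * m - (n + 1 / 2) -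
    -((α - (p (k + 1) : ℝ) / 2 ^ (b + 1)) * m) := by ring
  have e2 : (1 : ℝ) / 2 ^ (b + 1) = 1 / 2 ^ (b + 2) + 1 / 2 ^ (b + 2) := by
    rw [pow_succ _ (b + 1)]; field_simp; norm_num
  rw [e, hb]
  change 1 / 2 ^ (b + 2) ≤ _
  linarith

/-- Some multiples of `α` are close to half-integers. -/
theorem abs_sub_le (h : IsDyadicApprox α a p) (k : ℕ) :
    |α * ((2 ^ (a k - 1) : ℕ) : ℝ) - p k / 2| ≤ 2 ^ a k / 2 ^ a (k + 1) := by
  obtain ⟨b, hb⟩ : ∃ b, a k = b + 1 := ⟨a k - 1, by have := h.self_le k; omega⟩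
  have g1 := h.le k
  have g2 := h.le_add k
  rw [hb] at g1 g2 ⊢
  have e : α * ((2 ^ (b + 1 - 1) : ℕ) : ℝ) - p k / 2 = (α - p k / 2 ^ (b + 1)) * 2 ^ b := by
    rw [Nat.add_sub_cancel, pow_succ]; push_cast; field_simp
  rw [e, abs_of_nonneg (mul_nonneg (sub_nonneg.2 g1) (by positivity))]
  calc (α - p k / 2 ^ (b + 1)) * 2 ^ b ≤ 2 / 2 ^ a (k + 1) * 2 ^ b := by
        refine mul_le_mul_of_nonneg_right (by linarith) (by positivity)
    _ = 2 ^ (b + 1) / 2 ^ a (k + 1) := by rw [pow_succ]; ring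

theorem exists_exponent (h : IsDyadicApprox α a p) (m : ℕ) :
    ∃ k, m < 2 ^ (a (k + 1) - 1) ∧ (k = 0 ∨ 2 ^ (a k - 1) ≤ m) := by
  classical
  have hex : ∃ k, m < 2 ^ (a (k + 1) - 1) := by
    refine ⟨m, Nat.lt_two_pow_self.trans_le (Nat.pow_le_pow_right (by norm_num) ?_)⟩
    have := h.self_le (m + 1)
    omega
  refine ⟨Nat.find hex, Nat.find_spec hex, ?_⟩
  rcases hk : Nat.find hex with _ | k
  · exact Or.inl rfl
  · exact Or.inr (not_lt.1 (Nat.find_min hex (by omega)))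

end IsDyadicApprox

/-- The distances from the corner at which the two sides of the corner are touched by the
arc, namely the numbers `r ^ m` on one side and `(2 / 3) ^ (2 * n + 5)` on the other one, keep away
from each other at the rate `τ`. -/
def HasCornerBound (τ r : ℝ) : Prop :=
  ∃ C : ℝ, ∀ m n : ℕ, max (r ^ m) ((2 / 3) ^ (2 * n + 5)) ^ τ ≤
    C * |r ^ m - (2 / 3) ^ (2 * n + 5)|

theorem abs_exp_sub_exp_le (u v : ℝ) :
    |Real.exp u - Real.exp v| ≤ max (Real.exp u) (Real.exp v) * |u - v| := by
  wlog huv : v ≤ u generalizing u v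
  · rw [abs_sub_comm, max_comm, abs_sub_comm u]
    exact this v u (le_of_not_ge huv)
  have h1 := Real.exp_le_exp.2 huv
  rw [max_eq_left h1, abs_of_nonneg (sub_nonneg.2 h1), abs_of_nonneg (sub_nonneg.2 huv)]
  have h2 := Real.add_one_le_exp (v - u)
  have h3 : Real.exp v = Real.exp u * Real.exp (v - u) := by rw [← Real.exp_add]; congr 1; ring
  rw [h3]
  nlinarith [Real.exp_pos u]

theorem le_abs_exp_sub_exp (u v : ℝ) :
    max (Real.exp u) (Real.exp v) * |u - v| ≤ (1 + |u - v|) * |Real.exp u - Real.exp v| := by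
  wlog huv : v ≤ u generalizing u v
  · rw [abs_sub_comm (Real.exp u), max_comm, abs_sub_comm u]
    exact this v u (le_of_not_ge huv)
  have h1 := Real.exp_le_exp.2 huv
  rw [max_eq_left h1, abs_of_nonneg (sub_nonneg.2 h1), abs_of_nonneg (sub_nonneg.2 huv)]
  have h2 := Real.add_one_le_exp (u - v)
  have h3 : Real.exp u = Real.exp v * Real.exp (u - v) := by rw [← Real.exp_add]; congr 1; ring
  rw [h3]
  nlinarith [Real.exp_pos v]

/-- The constant `log (9 / 4)`. -/
noncomputable def logRatio : ℝ := Real.log (9 / 4)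

theorem logRatio_pos : 0 < logRatio := Real.log_pos (by norm_num)

theorem two_thirds_pow (n : ℕ) :
    (2 / 3 : ℝ) ^ (2 * n + 5) = Real.exp (-(logRatio * (n + 5 / 2))) := by
  have h1 : (2 / 3 : ℝ) = Real.exp (-(logRatio / 2)) := by
    have : logRatio = 2 * Real.log (3 / 2) := by
      rw [logRatio, show (9 / 4 : ℝ) = (3 / 2) ^ 2 by norm_num, Real.log_pow]; norm_num
    rw [this, mul_div_cancel_left₀ _ two_ne_zero, ← Real.log_inv, Real.exp_log] <;> norm_num
  rw [h1, ← Real.exp_nat_mul]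
  congr 1
  push_cast
  ring

theorem exp_neg_pow (α : ℝ) (m : ℕ) :
    Real.exp (-(logRatio * α)) ^ m = Real.exp (-(logRatio * (α * m))) := by
  rw [← Real.exp_nat_mul]; congr 1; ring

namespace IsDyadicApprox

variable {α : ℝ} {a p : ℕ → ℕ}

theorem abs_sub_pos (h : IsDyadicApprox α a p) (m n : ℕ) : 0 < |α * m - (n + 5 / 2)| := by
  obtain ⟨k, hk, -⟩ := h.exists_exponent m
  have h1 := h.le_abs_sub k m (n + 2) hk
  rw [show ((n + 2 : ℕ) : ℝ) + 1 / 2 = n + 5 / 2 by push_cast; ring] at h1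
  exact lt_of_lt_of_le (by positivity) h1

theorem pow_ne_pow (h : IsDyadicApprox α a p) (m n : ℕ) :
    Real.exp (-(logRatio * α)) ^ m ≠ (2 / 3) ^ (2 * n + 5) := by
  rw [exp_neg_pow, two_thirds_pow]
  intro h0
  have h1 := Real.exp_injective h0
  have h2 := h.abs_sub_pos m n
  rw [neg_inj, mul_right_inj' logRatio_pos.ne'] at h1
  rw [h1, sub_self, abs_zero] at h2
  exact lt_irrefl _ h2

theorem exp_mem_Ioo (h : IsDyadicApprox α a p) : Real.exp (-(logRatio * α)) ∈ Set.Ioo (1 / 3 : ℝ)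
    (4 / 9) := by
  have h4 : (4 / 9 : ℝ) = Real.exp (-logRatio) := by
    rw [logRatio, ← Real.log_inv, Real.exp_log] <;> norm_num
  have hL := logRatio_pos
  constructor
  · have h1 : Real.exp (-(logRatio * (5 / 4))) ≤ Real.exp (-(logRatio * α)) :=
      Real.exp_le_exp.2 (by nlinarith [h.le_five_fourths])
    refine lt_of_lt_of_le ?_ h1
    have h2 : Real.exp (-(logRatio * (5 / 4))) ^ 4 = (4 / 9) ^ 5 := by
      rw [h4, ← Real.exp_nat_mul, ← Real.exp_nat_mul]; congr 1; push_cast; ring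
    refine lt_of_pow_lt_pow_left₀ 4 (Real.exp_pos _).le ?_
    rw [h2]
    norm_num
  · rw [h4]
    exact Real.exp_lt_exp.2 (by nlinarith [h.one_lt])

theorem hasCornerBound (h : IsDyadicApprox α a p) {τ C : ℝ} (hτ : 1 ≤ τ)
    (hC : ∀ k, Real.exp (-(logRatio * (τ - 1) * (p k / 2))) * 2 ^ a (k + 1) ≤ C) :
    HasCornerBound τ (Real.exp (-(logRatio * α))) := by
  have hL := logRatio_pos
  set L := logRatio with hLdef
  have hα := h.one_lt
  set K : ℝ := 2 * max C (2 ^ a 1) with hK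
  have hKpos : 0 < K := by
    have : (0 : ℝ) < 2 ^ a 1 := by positivity
    have := lt_max_of_lt_right (b := C) this
    positivity
  -- the exponential of a multiple of `α` is dominated by the distance to the half-integers
  have key : ∀ m n : ℕ, Real.exp (-(L * (τ - 1) * (α * m))) ≤ K * |α * m - (n + 5 / 2)| := by
    intro m n
    obtain ⟨k, hk, hk'⟩ := h.exists_exponent m
    have h1 := h.le_abs_sub k m (n + 2) hk
    rw [show ((n + 2 : ℕ) : ℝ) + 1 / 2 = n + 5 / 2 by push_cast; ring] at h1
    have h2 : Real.exp (-(L * (τ - 1) * (α * m))) * 2 ^ a (k + 1) ≤ max C (2 ^ a 1) := by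
      rcases hk' with rfl | hm
      · refine le_max_of_le_right ?_
        have : Real.exp (-(L * (τ - 1) * (α * m))) ≤ 1 := by
          rw [Real.exp_le_one_iff, neg_nonpos]
          have := sub_nonneg.2 hτ
          positivity
        have h3 : (0 : ℝ) < 2 ^ a (0 + 1) := by positivity
        simp only [zero_add] at *
        nlinarith
      · refine le_max_of_le_left (le_trans ?_ (hC k))
        refine mul_le_mul_of_nonneg_right (Real.exp_le_exp.2 (neg_le_neg ?_)) (by positivity)
        refine mul_le_mul_of_nonneg_left ?_ (mul_nonneg hL.le (sub_nonneg.2 hτ))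
        have h3 := h.le k
        have hm' : (2 : ℝ) ^ (a k - 1) ≤ m := by exact_mod_cast hm
        have e : (p k : ℝ) / 2 = p k / 2 ^ a k * 2 ^ (a k - 1) := by
          obtain ⟨b, hb⟩ : ∃ b, a k = b + 1 := ⟨a k - 1, by have := h.self_le k; omega⟩
          rw [hb, Nat.add_sub_cancel, pow_succ]; field_simp
        rw [e]
        exact mul_le_mul h3 hm' (by positivity) (by linarith)
    have h3 : Real.exp (-(L * (τ - 1) * (α * m))) ≤ max C (2 ^ a 1) * (1 / 2 ^ a (k + 1)) := by
      rw [mul_one_div, le_div_iff₀ (by positivity)]; exact h2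
    have h4 : (1 : ℝ) / 2 ^ a (k + 1) = 2 * (1 / 2 ^ (a (k + 1) + 1)) := by
      rw [pow_succ]; field_simp
    have h5 : 0 ≤ max C (2 ^ a 1) := by rw [hK] at hKpos; linarith
    rw [h4] at h3
    rw [hK]
    nlinarith
  set D : ℝ := (1 + L) * (1 / L) * (1 + Real.exp (L * (τ - 1)) * K) with hD
  refine ⟨D, fun m n => ?_⟩
  rw [exp_neg_pow, two_thirds_pow, ← hLdef]
  set u := α * m with hu
  set v : ℝ := n + 5 / 2 with hv
  have hu0 : 0 ≤ u := by positivity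
  have hv0 : 0 ≤ v := by positivity
  set M := max (Real.exp (-(L * u))) (Real.exp (-(L * v))) with hM
  have hMpos : 0 < M := lt_max_of_lt_left (Real.exp_pos _)
  have hM1 : M ≤ 1 := max_le
    (by rw [Real.exp_le_one_iff, neg_nonpos]; positivity)
    (by rw [Real.exp_le_one_iff, neg_nonpos]; positivity)
  have h1 := le_abs_exp_sub_exp (-(L * u)) (-(L * v))
  rw [← hM, show -(L * u) - -(L * v) = -(L * (u - v)) by ring, abs_neg, abs_mul,
    abs_of_pos hL] at h1
  set δ := |u - v| with hδ
  have hδpos : 0 < δ := h.abs_sub_pos m n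
  set E := |Real.exp (-(L * u)) - Real.exp (-(L * v))| with hE
  have hE0 : 0 ≤ E := abs_nonneg _
  have e1 : M ^ τ = M ^ (τ - 1) * M := by
    rw [← Real.rpow_add_one hMpos.ne']; congr 1; ring
  have hpow0 : 0 ≤ M ^ (τ - 1) := Real.rpow_nonneg hMpos.le _
  have hKE : 0 ≤ Real.exp (L * (τ - 1)) * K := by positivity
  -- it suffices to bound the power of the maximum by the distance of the exponents
  have h2 : M ^ (τ - 1) * (1 + L * δ) ≤ (1 + L) * (1 + Real.exp (L * (τ - 1)) * K) * δ := by
    rcases le_total 1 δ with hδ1 | hδ1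
    · have : M ^ (τ - 1) ≤ 1 := Real.rpow_le_one hMpos.le hM1 (by linarith)
      calc M ^ (τ - 1) * (1 + L * δ) ≤ 1 * (1 + L * δ) :=
            mul_le_mul_of_nonneg_right this (by positivity)
        _ ≤ (1 + L) * 1 * δ := by nlinarith
        _ ≤ _ := by
          refine mul_le_mul_of_nonneg_right ?_ hδpos.le
          exact mul_le_mul_of_nonneg_left (by linarith) (by positivity)
    · have h3 : M ≤ Real.exp (-(L * (u - 1))) := by
        have := abs_le.1 hδ1
        refine max_le (Real.exp_le_exp.2 ?_) (Real.exp_le_exp.2 ?_) <;> nlinarith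
      have h4 : M ^ (τ - 1) ≤ Real.exp (L * (τ - 1)) * (K * δ) := by
        calc M ^ (τ - 1) ≤ Real.exp (-(L * (u - 1))) ^ (τ - 1) :=
              Real.rpow_le_rpow hMpos.le h3 (by linarith)
          _ = Real.exp (L * (τ - 1)) * Real.exp (-(L * (τ - 1) * u)) := by
              rw [← Real.exp_mul, ← Real.exp_add]; congr 1; ring
          _ ≤ _ := mul_le_mul_of_nonneg_left (key m n) (Real.exp_pos _).le
      calc M ^ (τ - 1) * (1 + L * δ) ≤ Real.exp (L * (τ - 1)) * (K * δ) * (1 + L) :=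
            mul_le_mul h4 (by nlinarith) (by positivity) (by positivity)
        _ ≤ _ := by
            have : 0 ≤ (1 + L) * δ := by positivity
            nlinarith
  have h3 : M ^ τ * (L * δ) ≤ D * E * (L * δ) := by
    calc M ^ τ * (L * δ) = M ^ (τ - 1) * (M * (L * δ)) := by rw [e1]; ring
      _ ≤ M ^ (τ - 1) * ((1 + L * δ) * E) := mul_le_mul_of_nonneg_left h1 hpow0
      _ = M ^ (τ - 1) * (1 + L * δ) * E := by ring
      _ ≤ (1 + L) * (1 + Real.exp (L * (τ - 1)) * K) * δ * E :=
          mul_le_mul_of_nonneg_right h2 hE0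
      _ = D * E * (L * δ) := by rw [hD]; field_simp
  exact le_of_mul_le_mul_right h3 (by positivity)

theorem exists_le_of_hasCornerBound (h : IsDyadicApprox α a p) {τ : ℝ} (hτ : 1 ≤ τ)
    (hb : HasCornerBound τ (Real.exp (-(logRatio * α)))) :
    ∃ C, 0 < C ∧ ∀ k,
      Real.exp (-(logRatio * (τ - 1) * (p k / 2))) * 2 ^ a (k + 1) ≤ C * 2 ^ a k := by
  obtain ⟨C, hC⟩ := hb
  have hL := logRatio_pos
  refine ⟨(|C| + 1) * logRatio, by positivity, fun k => ?_⟩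
  set L := logRatio with hLdef
  have hp8 : 8 ≤ p k := by
    refine le_trans ?_ (h.pow_le k)
    calc 8 = 2 ^ 3 := by norm_num
      _ ≤ 2 ^ a k := Nat.pow_le_pow_right (by norm_num) (by have := h.self_le k; omega)
  obtain ⟨q, hq⟩ := h.odd k
  obtain ⟨n, rfl⟩ : ∃ n, q = n + 2 := ⟨q - 2, by omega⟩
  have hv : (n : ℝ) + 5 / 2 = p k / 2 := by rw [hq]; push_cast; ring
  have h1 := hC (2 ^ (a k - 1)) n
  have h2 := h.abs_sub_le k
  rw [exp_neg_pow, two_thirds_pow, ← hLdef, hv] at h1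
  set u := α * ((2 ^ (a k - 1) : ℕ) : ℝ) with hu
  set v : ℝ := p k / 2 with hvdef
  set M := max (Real.exp (-(L * u))) (Real.exp (-(L * v))) with hM
  have hMpos : 0 < M := lt_max_of_lt_left (Real.exp_pos _)
  have h3 := abs_exp_sub_exp_le (-(L * u)) (-(L * v))
  rw [← hM, show -(L * u) - -(L * v) = -(L * (u - v)) by ring, abs_neg, abs_mul,
    abs_of_pos hL] at h3
  have e1 : M ^ τ = M ^ (τ - 1) * M := by
    rw [← Real.rpow_add_one hMpos.ne']; congr 1; ring
  have h4 : M ^ (τ - 1) * M ≤ (|C| + 1) * (L * |u - v|) * M := by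
    rw [← e1]
    refine h1.trans ?_
    calc _ ≤ (|C| + 1) * |Real.exp (-(L * u)) - Real.exp (-(L * v))| :=
          mul_le_mul_of_nonneg_right (by linarith [le_abs_self C]) (abs_nonneg _)
      _ ≤ (|C| + 1) * (M * (L * |u - v|)) :=
          mul_le_mul_of_nonneg_left h3 (by positivity)
      _ = _ := by ring
  have h5 := le_of_mul_le_mul_right h4 hMpos
  have h6 : Real.exp (-(L * (τ - 1) * v)) ≤ M ^ (τ - 1) := by
    calc _ = Real.exp (-(L * v)) ^ (τ - 1) := by rw [← Real.exp_mul]; congr 1; ring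
      _ ≤ _ := Real.rpow_le_rpow (Real.exp_pos _).le (le_max_right _ _) (by linarith)
  calc Real.exp (-(L * (τ - 1) * v)) * 2 ^ a (k + 1)
      ≤ (|C| + 1) * (L * (2 ^ a k / 2 ^ a (k + 1))) * 2 ^ a (k + 1) := by
        refine mul_le_mul_of_nonneg_right ((h6.trans h5).trans ?_) (by positivity)
        gcongr
    _ = _ := by field_simp

end IsDyadicApprox

end RegularArc

namespace RegularArc

open Filter Topology

theorem tendsto_mul_exp_neg {ε : ℝ} (hε : 0 < ε) (n : ℕ) :
    Tendsto (fun x : ℝ => x ^ n * Real.exp (-(ε * x))) atTop (𝓝 0) := by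
  have h := (Real.tendsto_pow_mul_exp_neg_atTop_nhds_zero n).comp
    (tendsto_id.const_mul_atTop hε)
  have h2 := h.const_mul ((1 / ε) ^ n)
  rw [mul_zero] at h2
  refine h2.congr fun x => ?_
  simp only [Function.comp, id, ← mul_assoc, ← mul_pow]
  rw [one_div_mul_cancel hε.ne', one_mul]

theorem le_two_pow_ceil (x : ℝ) : Real.exp (x * Real.log 2) ≤ 2 ^ ⌈x⌉₊ := by
  have h := Nat.le_ceil x
  rw [← Real.exp_log (by norm_num : (0 : ℝ) < 2), ← Real.exp_nat_mul, Real.exp_log (by norm_num)]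
  exact Real.exp_le_exp.2 (mul_le_mul_of_nonneg_right h (Real.log_nonneg (by norm_num)))

theorem two_pow_ceil_le {x : ℝ} (hx : 0 ≤ x) : 2 ^ ⌈x⌉₊ ≤ 2 * Real.exp (x * Real.log 2) := by
  have h := (Nat.ceil_lt_add_one hx).le
  calc (2 : ℝ) ^ ⌈x⌉₊ = Real.exp (⌈x⌉₊ * Real.log 2) := by
        rw [Real.exp_nat_mul, Real.exp_log (by norm_num)]
    _ ≤ Real.exp ((x + 1) * Real.log 2) :=
        Real.exp_le_exp.2 (mul_le_mul_of_nonneg_right h (Real.log_nonneg (by norm_num)))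
    _ = 2 * Real.exp (x * Real.log 2) := by
        rw [add_mul, one_mul, Real.exp_add, Real.exp_log (by norm_num), mul_comm]

theorem two_mul_add_one_le_two_pow {a : ℕ} (ha : 3 ≤ a) : 2 * a + 1 ≤ 2 ^ a := by
  induction a, ha using Nat.le_induction with
  | base => norm_num
  | succ a ha ih => rw [pow_succ]; omega

theorem IsDyadicApprox.pow_le_cast {α : ℝ} {a p : ℕ → ℕ} (h : IsDyadicApprox α a p) (k : ℕ) :
    (2 : ℝ) ^ a k ≤ p k := by exact_mod_cast h.pow_le k

/-- There are ratios for which the corner bound fails for every rate. -/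
theorem exists_forall_not_hasCornerBound :
    ∃ r ∈ Set.Ioo (1 / 3 : ℝ) (4 / 9), (∀ m n : ℕ, r ^ m ≠ (2 / 3) ^ (2 * n + 5)) ∧
      ∀ τ : ℝ, 1 ≤ τ → ¬ HasCornerBound τ r := by
  obtain ⟨α, a, p, h, hF⟩ := exists_isDyadicApprox (fun _ p => p ^ 2) (le_refl 3)
    (fun a p ha hp => (two_mul_add_one_le_two_pow ha).trans
      (hp.trans (Nat.le_self_pow two_ne_zero p)))
  refine ⟨_, h.exp_mem_Ioo, h.pow_ne_pow, fun τ hτ hb => ?_⟩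
  obtain ⟨C, hC0, hC⟩ := h.exists_le_of_hasCornerBound hτ hb
  set s := logRatio * (τ - 1) / 2 with hs
  have hl2 : 0 < Real.log 2 := Real.log_pos (by norm_num)
  have hlim := (tendsto_mul_exp_neg one_pos 1).comp h.tendsto_numerator
  have h1 := hlim.eventually (gt_mem_nhds (inv_pos.2 hC0))
  have h2 := h.tendsto_numerator.eventually (eventually_ge_atTop ((s + 1) / Real.log 2))
  obtain ⟨k, h1, h2⟩ := (h1.and h2).exists
  simp only [Function.comp, pow_one, one_mul] at h1
  rw [div_le_iff₀ hl2] at h2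
  have h3 := (hC k).trans (mul_le_mul_of_nonneg_left (h.pow_le_cast k) hC0.le)
  have hp0 : (0 : ℝ) ≤ p k := Nat.cast_nonneg _
  have h4 : Real.exp (p k) ≤
      Real.exp (-(logRatio * (τ - 1) * (p k / 2))) * 2 ^ a (k + 1) := by
    rw [hF, ← Real.exp_log (by norm_num : (0 : ℝ) < 2), ← Real.exp_nat_mul, Real.exp_log
      (by norm_num), ← Real.exp_add]
    refine Real.exp_le_exp.2 ?_
    have : logRatio * (τ - 1) * (p k / 2) = s * p k := by rw [hs]; ring
    rw [this]
    push_cast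
    nlinarith
  have h5 := h4.trans h3
  rw [Real.exp_neg, ← div_eq_mul_inv, div_lt_iff₀ (Real.exp_pos _), ← div_eq_inv_mul,
    lt_div_iff₀ hC0] at h1
  linarith

/-- Each rate greater than one is the optimal one for some ratio, and is attained. -/
theorem exists_hasCornerBound_iff_le {t₀ : ℝ} (ht₀ : 1 < t₀) :
    ∃ r ∈ Set.Ioo (1 / 3 : ℝ) (4 / 9), (∀ m n : ℕ, r ^ m ≠ (2 / 3) ^ (2 * n + 5)) ∧
      HasCornerBound t₀ r ∧ ∀ τ : ℝ, 1 ≤ τ → τ < t₀ → ¬ HasCornerBound τ r := by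
  have hl2 : 0 < Real.log 2 := Real.log_pos (by norm_num)
  have hL := logRatio_pos
  set c := logRatio * (t₀ - 1) / (2 * Real.log 2) with hc
  have hc0 : 0 < c := by
    have := sub_pos.2 ht₀
    positivity
  have hcl : ∀ x : ℝ, c * x * Real.log 2 = logRatio * (t₀ - 1) * (x / 2) := fun x => by
    rw [hc]; field_simp
  obtain ⟨a₀, ha₀⟩ : ∃ a₀ : ℕ, ∀ a : ℕ, a₀ ≤ a → (2 * a + 1 : ℝ) ≤ c * 2 ^ a := by
    have h1 := tendsto_pow_const_div_const_pow_of_one_lt 1 (by norm_num : (1 : ℝ) < 2)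
    have h2 := h1.eventually (gt_mem_nhds (by positivity : 0 < c / 3))
    obtain ⟨a₀, h3⟩ := eventually_atTop.1 (h2.and (eventually_ge_atTop 1))
    refine ⟨a₀, fun a ha => ?_⟩
    obtain ⟨h4, h5⟩ := h3 a ha
    rw [pow_one, div_lt_iff₀ (by positivity)] at h4
    have h5' : (1 : ℝ) ≤ a := by exact_mod_cast h5
    linarith
  obtain ⟨α, a, p, h, hF⟩ := exists_isDyadicApprox (fun _ p => ⌈c * p⌉₊) (le_max_left 3 a₀)
    (fun a p ha hp => by
      have h1 := ha₀ a ((le_max_right _ _).trans ha)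
      have h2 : (2 : ℝ) ^ a ≤ p := by exact_mod_cast hp
      have h3 : ((2 * a + 1 : ℕ) : ℝ) ≤ (⌈c * p⌉₊ : ℝ) := by
        push_cast
        exact h1.trans ((mul_le_mul_of_nonneg_left h2 hc0.le).trans (Nat.le_ceil _))
      exact_mod_cast h3)
  refine ⟨_, h.exp_mem_Ioo, h.pow_ne_pow, h.hasCornerBound (C := 2) ht₀.le fun k => ?_,
    fun τ hτ hτt hb => ?_⟩
  · rw [hF, Real.exp_neg, ← hcl, ← div_eq_inv_mul, div_le_iff₀ (Real.exp_pos _)]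
    exact two_pow_ceil_le (by positivity)
  · obtain ⟨C, hC0, hC⟩ := h.exists_le_of_hasCornerBound hτ hb
    have hε : 0 < logRatio * (t₀ - τ) / 2 := by
      have := sub_pos.2 hτt
      positivity
    have hlim := (tendsto_mul_exp_neg hε 1).comp h.tendsto_numerator
    obtain ⟨k, h1⟩ := (hlim.eventually (gt_mem_nhds (inv_pos.2 hC0))).exists
    simp only [Function.comp, pow_one] at h1
    have h3 := (hC k).trans (mul_le_mul_of_nonneg_left (h.pow_le_cast k) hC0.le)
    have h4 : Real.exp (logRatio * (t₀ - τ) / 2 * p k) ≤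
        Real.exp (-(logRatio * (τ - 1) * (p k / 2))) * 2 ^ a (k + 1) := by
      refine le_trans (le_of_eq ?_) (mul_le_mul_of_nonneg_left (hF k ▸ le_two_pow_ceil _)
        (Real.exp_pos _).le)
      rw [← Real.exp_add, hcl]
      congr 1
      ring
    have h5 := h4.trans h3
    rw [Real.exp_neg, ← div_eq_mul_inv, div_lt_iff₀ (Real.exp_pos _), ← div_eq_inv_mul,
      lt_div_iff₀ hC0] at h1
    linarith

/-- Each rate is the optimal one for some ratio, without being attained. -/
theorem exists_hasCornerBound_iff_lt {t₀ : ℝ} (ht₀ : 1 ≤ t₀) :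
    ∃ r ∈ Set.Ioo (1 / 3 : ℝ) (4 / 9), (∀ m n : ℕ, r ^ m ≠ (2 / 3) ^ (2 * n + 5)) ∧
      (∀ τ : ℝ, t₀ < τ → HasCornerBound τ r) ∧ ¬ HasCornerBound t₀ r := by
  have hl2 : 0 < Real.log 2 := Real.log_pos (by norm_num)
  have hL := logRatio_pos
  set c := logRatio * (t₀ - 1) / (2 * Real.log 2) with hc
  have hc0 : 0 ≤ c := by
    have := sub_nonneg.2 ht₀
    positivity
  have hcl : ∀ x : ℝ, c * x * Real.log 2 = logRatio * (t₀ - 1) * (x / 2) := fun x => by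
    rw [hc]; field_simp
  obtain ⟨α, a, p, h, hF⟩ := exists_isDyadicApprox (fun a p => ⌈c * p⌉₊ + (2 * a + 1))
    (le_refl 3) (fun a p _ _ => Nat.le_add_left _ _)
  refine ⟨_, h.exp_mem_Ioo, h.pow_ne_pow, fun τ hτ => ?_, fun hb => ?_⟩
  · have hε : 0 < logRatio * (τ - t₀) / 2 := by
      have := sub_pos.2 hτ
      positivity
    have hlim := (tendsto_mul_exp_neg hε 2).comp h.tendsto_numerator
    obtain ⟨B, hB⟩ := hlim.bddAbove_range
    refine h.hasCornerBound (C := 4 * B) (ht₀.trans hτ.le) fun k => ?_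
    have h1 : (p k : ℝ) ^ 2 * Real.exp (-(logRatio * (τ - t₀) / 2 * p k)) ≤ B :=
      hB ⟨k, rfl⟩
    have h2 : (2 : ℝ) ^ a (k + 1) ≤
        2 * Real.exp (logRatio * (t₀ - 1) * (p k / 2)) * (2 * p k ^ 2) := by
      rw [hF, pow_add, ← hcl]
      refine mul_le_mul (two_pow_ceil_le (by positivity)) ?_ (by positivity) (by positivity)
      rw [pow_succ, mul_comm 2 (a k), pow_mul, mul_comm]
      have := h.pow_le_cast k
      gcongr
    calc _ ≤ Real.exp (-(logRatio * (τ - 1) * (p k / 2))) *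
          (2 * Real.exp (logRatio * (t₀ - 1) * (p k / 2)) * (2 * p k ^ 2)) :=
          mul_le_mul_of_nonneg_left h2 (Real.exp_pos _).le
      _ = 4 * (p k ^ 2 * (Real.exp (-(logRatio * (τ - 1) * (p k / 2))) *
          Real.exp (logRatio * (t₀ - 1) * (p k / 2)))) := by ring
      _ = 4 * (p k ^ 2 * Real.exp (-(logRatio * (τ - t₀) / 2 * p k))) := by
          rw [← Real.exp_add]; congr 4; ring
      _ ≤ _ := by linarith
  · obtain ⟨C, hC0, hC⟩ := h.exists_le_of_hasCornerBound ht₀ hb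
    have h2 := (tendsto_pow_atTop_atTop_of_one_lt (by norm_num : (1 : ℝ) < 2)).comp
      h.tendsto_exponent
    obtain ⟨k, hk⟩ := (h2.eventually (eventually_gt_atTop C)).exists
    simp only [Function.comp] at hk
    have h3 : (2 : ℝ) ^ a k * 2 ^ a k ≤
        Real.exp (-(logRatio * (t₀ - 1) * (p k / 2))) * 2 ^ a (k + 1) := by
      have h4 : Real.exp (logRatio * (t₀ - 1) * (p k / 2)) * (2 ^ a k * 2 ^ a k) ≤
          2 ^ a (k + 1) := by
        rw [hF, pow_add, ← hcl]
        refine mul_le_mul (le_two_pow_ceil _) ?_ (by positivity) (by positivity)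
        rw [← pow_add]
        exact pow_le_pow_right₀ (by norm_num) (by omega)
      rw [Real.exp_neg, ← div_eq_inv_mul, le_div_iff₀ (Real.exp_pos _), mul_comm]
      exact h4
    have h5 := le_of_mul_le_mul_right (h3.trans (hC k)) (by positivity)
    linarith

end RegularArc

namespace RegularArc

/-- The argument is positive for numbers off the real axis. -/
theorem argPos_pos {z : ℂ} (hz : z.im ≠ 0) : 0 < argPos z := by
  refine lt_of_le_of_ne (left_le_toIcoMod _ _ _) fun h => hz ?_
  have h1 := self_sub_toIcoDiv_zsmul Real.two_pi_pos 0 (Complex.arg z)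
  have h2 : toIcoMod Real.two_pi_pos 0 (Complex.arg z) = 0 := h.symm
  rw [h2, sub_eq_zero, zsmul_eq_mul] at h1
  set k := toIcoDiv Real.two_pi_pos 0 (Complex.arg z)
  have h3 := Complex.neg_pi_lt_arg z
  have h4 := Complex.arg_le_pi z
  have hpi := Real.pi_pos
  have hk : k = 0 := by
    have k1 : (k : ℝ) < 1 := by nlinarith
    have k2 : (-1 : ℝ) < k := by nlinarith
    have k3 : k < 1 := by exact_mod_cast k1
    have k4 : -1 < k := by exact_mod_cast k2
    omega
  rw [hk, Int.cast_zero, zero_mul, Complex.arg_eq_zero_iff] at h1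
  exact h1.2

theorem argPos_nonneg (z : ℂ) : 0 ≤ argPos z := left_le_toIcoMod _ _ _

theorem argPos_ofReal {x : ℝ} (hx : 0 ≤ x) : argPos x = 0 := by
  rw [argPos, Complex.arg_ofReal_of_nonneg hx]
  exact toIcoMod_apply_left _ _

/-- The closed triangle with corners `0`, `1` and `1 / 2 + i / 4`. -/
def flatTriangle : Set ℂ := {z | 0 ≤ z.im ∧ 2 * z.im ≤ z.re ∧ 2 * z.im ≤ 1 - z.re}

theorem isClosed_flatTriangle : IsClosed flatTriangle :=
  (isClosed_le continuous_const Complex.continuous_im).inter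
    ((isClosed_le (continuous_const.mul Complex.continuous_im) Complex.continuous_re).inter
      (isClosed_le (continuous_const.mul Complex.continuous_im)
        (continuous_const.sub Complex.continuous_re)))

theorem convex_flatTriangle : Convex ℝ flatTriangle := by
  rintro x ⟨hx1, hx2, hx3⟩ y ⟨hy1, hy2, hy3⟩ a b ha hb hab
  refine ⟨?_, ?_, ?_⟩ <;>
    simp only [Complex.add_re, Complex.add_im, Complex.real_smul, Complex.mul_re, Complex.mul_im,
      Complex.ofReal_re, Complex.ofReal_im] <;> nlinarith

theorem convexHull_eq_flatTriangle :
    convexHull ℝ ({⟨0, 0⟩, ⟨1, 0⟩, ⟨1 / 2, 1 / 4⟩} : Set ℂ) = flatTriangle := by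
  apply Set.Subset.antisymm
  · refine convexHull_min ?_ convex_flatTriangle
    rintro z (rfl | rfl | rfl) <;> refine ⟨?_, ?_, ?_⟩ <;> norm_num
  · rintro z ⟨h1, h2, h3⟩
    rw [mem_convexHull_iff]
    intro t ht hconv
    have := hconv.sum_mem (t := Finset.univ)
      (w := ![1 - z.re - 2 * z.im, z.re - 2 * z.im, 4 * z.im])
      (z := ![⟨0, 0⟩, ⟨1, 0⟩, ⟨1 / 2, 1 / 4⟩]) ?_ ?_ ?_
    · convert this
      rw [Fin.sum_univ_three]
      apply Complex.ext <;> simp <;> ring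
    · intro i _
      fin_cases i <;> simp <;> linarith
    · rw [Fin.sum_univ_three]; simp; ring
    · intro i _
      apply ht
      fin_cases i <;> simp

theorem interior_flatTriangle :
    interior flatTriangle = {z | 0 < z.im ∧ 2 * z.im < z.re ∧ 2 * z.im < 1 - z.re} := by
  apply Set.Subset.antisymm
  · intro z hz
    rw [mem_interior_iff_mem_nhds, Metric.mem_nhds_iff] at hz
    obtain ⟨ε, hε, hball⟩ := hz
    have hmem : ∀ v : ℂ, ‖v‖ ≤ 1 → z + ((ε / 2 : ℝ) : ℂ) * v ∈ flatTriangle := by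
      intro v hv
      apply hball
      rw [Metric.mem_ball, dist_eq_norm, add_sub_cancel_left, norm_mul, Complex.norm_real,
        Real.norm_of_nonneg (by positivity)]
      nlinarith
    have h1 := hmem (-Complex.I) (by simp)
    have h2 := hmem (-1) (by simp)
    have h3 := hmem 1 (by simp)
    simp only [flatTriangle, Set.mem_ofPred_eq, Complex.add_re, Complex.add_im, Complex.mul_re,
      Complex.mul_im, Complex.ofReal_re, Complex.ofReal_im, Complex.neg_re, Complex.neg_im,
      Complex.I_re, Complex.I_im, Complex.one_re, Complex.one_im] at h1 h2 h3
    refine ⟨by linarith [h1.1], by linarith [h2.2.1], by linarith [h3.2.2]⟩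
  · refine interior_maximal (fun z hz => ⟨hz.1.le, hz.2.1.le, hz.2.2.le⟩) ?_
    exact (isOpen_lt continuous_const Complex.continuous_im).inter
      ((isOpen_lt (continuous_const.mul Complex.continuous_im) Complex.continuous_re).inter
        (isOpen_lt (continuous_const.mul Complex.continuous_im)
          (continuous_const.sub Complex.continuous_re)))

theorem closure_interior_flatTriangle : closure (interior flatTriangle) = flatTriangle := by
  rw [convex_flatTriangle.closure_interior_eq_closure_of_nonempty_interior,
    isClosed_flatTriangle.closure_eq]
  rw [interior_flatTriangle]
  exact ⟨⟨1 / 2, 1 / 8⟩, by norm_num, by norm_num, by norm_num⟩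

theorem dist_le_two_of_mem_flatTriangle {z z' : ℂ} (hz : z ∈ flatTriangle)
    (hz' : z' ∈ flatTriangle) : dist z z' ≤ 2 := by
  obtain ⟨h1, h2, h3⟩ := hz
  obtain ⟨h1', h2', h3'⟩ := hz'
  rw [dist_eq_norm]
  refine (Complex.norm_le_abs_re_add_abs_im _).trans ?_
  rw [Complex.sub_re, Complex.sub_im]
  have e1 : |z.re - z'.re| ≤ 1 := abs_le.2 ⟨by linarith, by linarith⟩
  have e2 : |z.im - z'.im| ≤ 1 := abs_le.2 ⟨by linarith, by linarith⟩
  linarith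

/-- A one-parameter family of polygons whose triangles at the vertex `4 / 9` have a common
side. -/
noncomputable def cornerPolygon (r : ℝ) : Polygon where
  ℓ := 5
  A
    | 0 => ⟨0, 0⟩
    | 1 => ⟨4 / 9, 0⟩
    | 2 => ⟨1492 / 3645, 512 / 10935⟩
    | 3 => ⟨1 / 2, 1 / 4⟩
    | 4 => ⟨1 - r, 0⟩
    | _ => ⟨1, 0⟩
  q := 3

namespace cornerPolygon

variable (r : ℝ)

theorem A_zero : (cornerPolygon r).A 0 = ⟨0, 0⟩ := rfl
theorem A_one : (cornerPolygon r).A 1 = ⟨4 / 9, 0⟩ := rfl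
theorem A_two : (cornerPolygon r).A 2 = ⟨1492 / 3645, 512 / 10935⟩ := rfl
theorem A_three : (cornerPolygon r).A 3 = ⟨1 / 2, 1 / 4⟩ := rfl
theorem A_four : (cornerPolygon r).A 4 = ⟨1 - r, 0⟩ := rfl
theorem A_five : (cornerPolygon r).A 5 = ⟨1, 0⟩ := rfl
theorem ℓ_eq : (cornerPolygon r).ℓ = 5 := rfl
theorem q_eq : (cornerPolygon r).q = 3 := rfl

theorem ratio_eq (j : ℕ) :
    (cornerPolygon r).ratio j = (cornerPolygon r).A j - (cornerPolygon r).A (j - 1) := by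
  have h : (⟨1, 0⟩ : ℂ) - ⟨0, 0⟩ = 1 := by apply Complex.ext <;> simp
  rw [Polygon.ratio, ℓ_eq, A_five, A_zero, h, div_one]

theorem S_eq (j : ℕ) (z : ℂ) : (cornerPolygon r).S j z = (cornerPolygon r).A (j - 1) +
    ((cornerPolygon r).A j - (cornerPolygon r).A (j - 1)) * z := by
  have h : (⟨0, 0⟩ : ℂ) = 0 := rfl
  rw [Polygon.S_eq, ratio_eq, A_zero, h, sub_zero]

theorem S_one (z : ℂ) : (cornerPolygon r).S 1 z = ⟨4 / 9 * z.re, 4 / 9 * z.im⟩ := by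
  rw [S_eq]
  apply Complex.ext <;> simp [A_zero, A_one]

theorem S_two (z : ℂ) : (cornerPolygon r).S 2 z =
    ⟨4 / 9 - 128 / 3645 * z.re - 512 / 10935 * z.im, 512 / 10935 * z.re - 128 / 3645 * z.im⟩ := by
  rw [S_eq]
  apply Complex.ext <;> simp [A_one, A_two] <;> ring

theorem S_three (z : ℂ) : (cornerPolygon r).S 3 z =
    ⟨1492 / 3645 + 661 / 7290 * z.re - 8887 / 43740 * z.im,
      512 / 10935 + 8887 / 43740 * z.re + 661 / 7290 * z.im⟩ := by
  rw [S_eq]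
  apply Complex.ext <;> simp [A_two, A_three] <;> ring

theorem S_four (z : ℂ) : (cornerPolygon r).S 4 z =
    ⟨1 / 2 + (1 / 2 - r) * z.re + 1 / 4 * z.im, 1 / 4 - 1 / 4 * z.re + (1 / 2 - r) * z.im⟩ := by
  rw [S_eq]
  apply Complex.ext <;> simp [A_three, A_four] <;> ring

theorem S_five (z : ℂ) : (cornerPolygon r).S 5 z = ⟨1 - r + r * z.re, r * z.im⟩ := by
  rw [S_eq]
  apply Complex.ext <;> simp [A_four, A_five]

theorem openTriangle_eq : (cornerPolygon r).openTriangle =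
    {z | 0 < z.im ∧ 2 * z.im < z.re ∧ 2 * z.im < 1 - z.re} := by
  rw [← interior_flatTriangle, ← convexHull_eq_flatTriangle]
  rfl

theorem triangle_eq : (cornerPolygon r).triangle = flatTriangle := by
  rw [Polygon.triangle, openTriangle_eq, ← interior_flatTriangle, closure_interior_flatTriangle]

theorem thetaMin_eq_zero : (cornerPolygon r).thetaMin = 0 := by
  apply le_antisymm
  · refine csInf_le ⟨0, ?_⟩ ⟨1, ⟨le_rfl, by rw [ℓ_eq]; norm_num⟩, ?_⟩
    · rintro _ ⟨p, -, rfl⟩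
      exact argPos_nonneg _
    · rw [Polygon.theta, q_eq, A_one, A_three, S_one, S_two]
      have h : ((⟨4 / 9 * (1 / 2), 4 / 9 * (1 / 4)⟩ : ℂ) - ⟨4 / 9, 0⟩) =
          ((243 / 32 : ℝ) : ℂ) * (⟨4 / 9 - 128 / 3645 * (1 / 2) - 512 / 10935 * (1 / 4),
          512 / 10935 * (1 / 2) - 128 / 3645 * (1 / 4)⟩ - ⟨4 / 9, 0⟩) := by
        apply Complex.ext <;> simp <;> norm_num
      have h0 : ((⟨4 / 9 - 128 / 3645 * (1 / 2) - 512 / 10935 * (1 / 4),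
          512 / 10935 * (1 / 2) - 128 / 3645 * (1 / 4)⟩ : ℂ) - ⟨4 / 9, 0⟩) ≠ 0 := by
        intro h
        have := congrArg Complex.im h
        norm_num at this
      simp only
      rw [h, mul_div_cancel_right₀ _ h0]
      exact argPos_ofReal (by norm_num)
  · refine Real.sInf_nonneg ?_
    rintro _ ⟨p, -, rfl⟩
    exact argPos_nonneg _

variable {r}

theorem injOn_A (hr : r ∈ Set.Ioo (1 / 3 : ℝ) (4 / 9)) : Set.InjOn (cornerPolygon r).A (Set.Iic
    (cornerPolygon r).ℓ) := by
  intro i hi j hj h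
  obtain ⟨hr1, hr2⟩ := hr
  rw [Set.mem_Iic, ℓ_eq] at hi hj
  have h1 := congrArg Complex.re h
  interval_cases i <;> interval_cases j <;> first
    | rfl
    | (simp only [A_zero, A_one, A_two, A_three, A_four, A_five] at h1
       exfalso
       linarith)

theorem norm_ratio_lt_one (hr : r ∈ Set.Ioo (1 / 3 : ℝ) (4 / 9)) (j : ℕ) (h1 : 1 ≤ j) (h5 : j ≤
    (cornerPolygon r).ℓ) :
    ‖(cornerPolygon r).ratio j‖ < 1 := by
  obtain ⟨hr1, hr2⟩ := hr
  rw [ratio_eq]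
  refine (Complex.norm_le_abs_re_add_abs_im _).trans_lt ?_
  rw [Complex.sub_re, Complex.sub_im]
  rw [ℓ_eq] at h5
  interval_cases j <;> simp only [Nat.sub_self, Nat.reduceSub, A_zero, A_one, A_two, A_three,
    A_four, A_five]
  · norm_num
  · norm_num
  · norm_num
  · rw [abs_of_pos (by linarith)]; norm_num; linarith
  · rw [abs_of_pos (by linarith)]; norm_num; linarith

theorem mapsTo_S (hr : r ∈ Set.Ioo (1 / 3 : ℝ) (4 / 9)) (j : ℕ) (h1 : 1 ≤ j) (h5 : j ≤
    (cornerPolygon r).ℓ) :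
    Set.MapsTo ((cornerPolygon r).S j) flatTriangle flatTriangle := by
  obtain ⟨hr1, hr2⟩ := hr
  rintro z ⟨z1, z2, z3⟩
  have e1 : 0 ≤ (1 / 2 - r) * z.im := mul_nonneg (by linarith) z1
  have e2 : 0 ≤ (1 / 2 - r) * (z.re - 2 * z.im) := mul_nonneg (by linarith) (by linarith)
  have e3 : 0 ≤ (1 / 2 - r) * (1 - z.re - 2 * z.im) := mul_nonneg (by linarith) (by linarith)
  have e4 : 0 ≤ (r - 1 / 3) * z.im := mul_nonneg (by linarith) z1
  have e5 : 0 ≤ (r - 1 / 3) * (z.re - 2 * z.im) := mul_nonneg (by linarith) (by linarith)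
  have e6 : 0 ≤ (r - 1 / 3) * (1 - z.re - 2 * z.im) := mul_nonneg (by linarith) (by linarith)
  rw [ℓ_eq] at h5
  interval_cases j
  · rw [S_one]; refine ⟨?_, ?_, ?_⟩ <;> simp only <;> linarith
  · rw [S_two]; refine ⟨?_, ?_, ?_⟩ <;> simp only <;> linarith
  · rw [S_three]; refine ⟨?_, ?_, ?_⟩ <;> simp only <;> linarith
  · rw [S_four]; refine ⟨?_, ?_, ?_⟩ <;> simp only <;> linarith
  · rw [S_five]; refine ⟨?_, ?_, ?_⟩ <;> simp only <;> linarith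

theorem S_ne_S (hr : r ∈ Set.Ioo (1 / 3 : ℝ) (4 / 9)) {i j : ℕ} (hi : 1 ≤ i) (hij : i + 1 < j)
    (hj : j ≤ (cornerPolygon r).ℓ) {z z' : ℂ}
    (hz : z ∈ flatTriangle) (hz' : z' ∈ flatTriangle) :
    (cornerPolygon r).S i z ≠ (cornerPolygon r).S j z' := by
  obtain ⟨hr1, hr2⟩ := hr
  obtain ⟨z1, z2, z3⟩ := hz
  obtain ⟨z1', z2', z3'⟩ := hz'
  have e1 : 0 ≤ (1 / 2 - r) * z'.re := mul_nonneg (by linarith) (by linarith)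
  have e2 : 0 ≤ r * z'.re := mul_nonneg (by linarith) (by linarith)
  intro h
  have hre := congrArg Complex.re h
  have him := congrArg Complex.im h
  rw [ℓ_eq] at hj
  have hi3 : i ≤ 3 := by omega
  interval_cases i <;> interval_cases j <;>
    simp only [S_one, S_two, S_three, S_four, S_five] at hre him <;> linarith

theorem disjoint_openTriangle (hr : r ∈ Set.Ioo (1 / 3 : ℝ) (4 / 9)) {i j : ℕ} (hi : 1 ≤ i)
    (hij : i < j)
    (hj : j ≤ (cornerPolygon r).ℓ) :
    Disjoint ((cornerPolygon r).S i '' (cornerPolygon r).openTriangle)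
      ((cornerPolygon r).S j '' (cornerPolygon r).openTriangle) := by
  rw [Set.disjoint_left, openTriangle_eq]
  rintro _ ⟨z, ⟨z1, z2, z3⟩, rfl⟩ ⟨z', ⟨z1', z2', z3'⟩, h⟩
  rcases (by omega : i + 1 < j ∨ j = i + 1) with h' | rfl
  · exact S_ne_S hr hi h' hj ⟨z1.le, z2.le, z3.le⟩ ⟨z1'.le, z2'.le, z3'.le⟩ h.symm
  obtain ⟨hr1, hr2⟩ := hr
  have e1 : 0 < (1 / 2 - r) * z'.re := mul_pos (by linarith) (by linarith)
  have e2 : 0 < (1 / 2 - r) * z.im := mul_pos (by linarith) (by linarith)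
  have e3 : 0 < r * (z'.re - 2 * z'.im) := mul_pos (by linarith) (by linarith)
  have e4 : 0 < r * z'.im := mul_pos (by linarith) z1'
  have e5 : 0 < (1 / 2 - r) * (1 - z.re - 2 * z.im) := mul_pos (by linarith) (by linarith)
  have hre := congrArg Complex.re h
  have him := congrArg Complex.im h
  rw [ℓ_eq] at hj
  have hi4 : i ≤ 4 := by omega
  interval_cases i <;> norm_num only at hre him <;>
    simp only [S_one, S_two, S_three, S_four, S_five] at hre him <;> linarith

theorem isBasicFigure (hr : r ∈ Set.Ioo (1 / 3 : ℝ) (4 / 9)) : (cornerPolygon r).IsBasicFigure where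
  q_pos := by rw [q_eq]; norm_num
  q_lt := by rw [q_eq, ℓ_eq]; norm_num
  vertices_injOn := injOn_A hr
  first_mem := by
    rw [ℓ_eq, A_zero, A_one, A_five]
    exact ⟨5 / 9, 4 / 9, by norm_num, by norm_num, by norm_num, by
      apply Complex.ext <;> simp⟩
  last_mem := by
    obtain ⟨hr1, hr2⟩ := hr
    rw [ℓ_eq, A_zero, show 5 - 1 = 4 from rfl, A_four, A_five]
    exact ⟨r, 1 - r, by linarith, by linarith, by ring, by
      apply Complex.ext <;> simp⟩
  last_mem' := by
    obtain ⟨hr1, hr2⟩ := hr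
    rw [ℓ_eq, A_one, show 5 - 1 = 4 from rfl, A_four, A_five]
    refine ⟨9 / 5 * r, 1 - 9 / 5 * r, by linarith, by linarith, by ring, ?_⟩
    apply Complex.ext <;> simp
    ring
  vertices_mem j hj := by
    obtain ⟨hr1, hr2⟩ := hr
    rw [ℓ_eq] at hj
    rw [openTriangle_eq, q_eq, ℓ_eq]
    interval_cases j
    · exact Or.inl (Or.inr (left_mem_segment ℝ _ _))
    · refine Or.inl (Or.inr ?_)
      rw [A_zero, A_one, A_five]
      exact ⟨5 / 9, 4 / 9, by norm_num, by norm_num, by norm_num, by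
        apply Complex.ext <;> simp⟩
    · refine Or.inr ?_
      rw [A_two]
      refine ⟨?_, ?_, ?_⟩ <;> norm_num
    · exact Or.inl (Or.inl rfl)
    · refine Or.inl (Or.inr ?_)
      rw [A_zero, A_four, A_five]
      exact ⟨r, 1 - r, by linarith, by linarith, by ring, by
        apply Complex.ext <;> simp⟩
    · exact Or.inl (Or.inr (right_mem_segment ℝ _ _))
  contractive := norm_ratio_lt_one hr
  disjoint i j := disjoint_openTriangle hr
  apex_mem j hj hjl := by
    rw [triangle_eq]
    refine mapsTo_S hr j hj hjl ?_
    rw [q_eq, A_three]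
    refine ⟨?_, ?_, ?_⟩ <;> norm_num
  sides j hj hjl h1 h5 h3 h4 := by
    rw [ℓ_eq] at hjl h5
    rw [q_eq] at h3 h4
    obtain rfl : j = 2 := by omega
    rw [triangle_eq, q_eq, ℓ_eq, A_three, A_zero, A_five, Set.eq_empty_iff_forall_notMem]
    rintro _ ⟨⟨z, ⟨z1, z2, z3⟩, rfl⟩, ⟨a, b, ha, hb, hab, h⟩ | ⟨a, b, ha, hb, hab, h⟩⟩
    all_goals
      rw [S_two] at h
      have hre := congrArg Complex.re h
      have him := congrArg Complex.im h
      simp at hre him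
      linarith
  orientation := by
    rw [q_eq, ℓ_eq, A_three, A_zero, A_five]
    have h : (⟨1, 0⟩ : ℂ) - ⟨0, 0⟩ = 1 := by apply Complex.ext <;> simp
    rw [h, div_one]
    simp

theorem characteristicAngle_pos (hr : r ∈ Set.Ioo (1 / 3 : ℝ) (4 / 9)) : 0 <
    (cornerPolygon r).characteristicAngle := by
  obtain ⟨hr1, hr2⟩ := hr
  rw [Polygon.characteristicAngle, thetaMin_eq_zero r, zero_add, lt_min_iff]
  constructor
  · refine argPos_pos ?_
    rw [q_eq, A_three, A_zero, S_three]
    rw [Complex.div_im]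
    simp [Complex.normSq]
    norm_num
  · refine argPos_pos ?_
    rw [q_eq, ℓ_eq, show 3 + 1 = 4 from rfl, A_three, A_five, S_four]
    rw [Complex.div_im, ← sub_div]
    refine div_ne_zero ?_ ?_
    · simp
      intro h
      linarith
    · rw [Complex.normSq_apply]
      simp
      intro h
      nlinarith

end cornerPolygon

end RegularArc

namespace RegularArc

/-- A real-linear functional which is positive on the directions of the corners of a triangle,
seen from the point `p`, is comparable with the distance from `p`; corners equal to `p` are
admitted. -/
theorem exists_mul_norm_le {a b : ℝ} {p v₁ v₂ v₃ : ℂ}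
    (h₁ : v₁ = p ∨ 0 < a * (v₁ - p).re + b * (v₁ - p).im)
    (h₂ : v₂ = p ∨ 0 < a * (v₂ - p).re + b * (v₂ - p).im)
    (h₃ : v₃ = p ∨ 0 < a * (v₃ - p).re + b * (v₃ - p).im) :
    ∃ κ : ℝ, 0 < κ ∧ ∀ x y z : ℝ, 0 ≤ x → 0 ≤ y → 0 ≤ z → x + y + z = 1 →
      κ * ‖x * v₁ + y * v₂ + z * v₃ - p‖ ≤ a * (x * v₁ + y * v₂ + z * v₃ - p).re +
        b * (x * v₁ + y * v₂ + z * v₃ - p).im := by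
  have key : ∀ v : ℂ, v = p ∨ 0 < a * (v - p).re + b * (v - p).im →
      ∃ κ : ℝ, 0 < κ ∧ κ * ‖v - p‖ ≤ a * (v - p).re + b * (v - p).im := by
    rintro v (rfl | hv)
    · exact ⟨1, one_pos, by simp⟩
    · refine ⟨(a * (v - p).re + b * (v - p).im) / (‖v - p‖ + 1), by positivity, ?_⟩
      rw [div_mul_eq_mul_div, div_le_iff₀ (by positivity)]
      nlinarith [norm_nonneg (v - p)]
  obtain ⟨κ₁, hκ₁, k₁⟩ := key v₁ h₁
  obtain ⟨κ₂, hκ₂, k₂⟩ := key v₂ h₂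
  obtain ⟨κ₃, hκ₃, k₃⟩ := key v₃ h₃
  refine ⟨min κ₁ (min κ₂ κ₃), by positivity, fun x y z hx hy hz hxyz => ?_⟩
  have e : (x * v₁ + y * v₂ + z * v₃ - p : ℂ) = x * (v₁ - p) + y * (v₂ - p) + z * (v₃ - p) := by
    have : (x + y + z : ℂ) = 1 := by exact_mod_cast hxyz
    linear_combination p * this
  rw [e]
  have hn : ‖x * (v₁ - p) + y * (v₂ - p) + z * (v₃ - p)‖ ≤
      x * ‖v₁ - p‖ + y * ‖v₂ - p‖ + z * ‖v₃ - p‖ := by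
    refine norm_add₃_le.trans (le_of_eq ?_)
    simp only [norm_mul, Complex.norm_real, Real.norm_of_nonneg hx, Real.norm_of_nonneg hy,
      Real.norm_of_nonneg hz]
  set κ := min κ₁ (min κ₂ κ₃)
  have hκ : 0 ≤ κ := by positivity
  have l₁ : κ * ‖v₁ - p‖ ≤ a * (v₁ - p).re + b * (v₁ - p).im :=
    (mul_le_mul_of_nonneg_right (min_le_left _ _) (norm_nonneg _)).trans k₁
  have l₂ : κ * ‖v₂ - p‖ ≤ a * (v₂ - p).re + b * (v₂ - p).im :=
    (mul_le_mul_of_nonneg_right ((min_le_right _ _).trans (min_le_left _ _))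
      (norm_nonneg _)).trans k₂
  have l₃ : κ * ‖v₃ - p‖ ≤ a * (v₃ - p).re + b * (v₃ - p).im :=
    (mul_le_mul_of_nonneg_right ((min_le_right _ _).trans (min_le_right _ _))
      (norm_nonneg _)).trans k₃
  have m₁ := mul_le_mul_of_nonneg_left l₁ hx
  have m₂ := mul_le_mul_of_nonneg_left l₂ hy
  have m₃ := mul_le_mul_of_nonneg_left l₃ hz
  have m := mul_le_mul_of_nonneg_left hn hκ
  simp only [Complex.add_re, Complex.add_im, Complex.re_ofReal_mul, Complex.im_ofReal_mul]
  linarith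

namespace cornerPolygon

variable {r : ℝ}

/-- The corner `1 / 2 + i / 4` of the triangle. -/
noncomputable def apex : ℂ := ⟨1 / 2, 1 / 4⟩

theorem exists_mul_norm_S_sub_le {a b : ℝ} {p : ℂ} {j : ℕ}
    (h₁ : (cornerPolygon r).A (j - 1) = p ∨ 0 < a * ((cornerPolygon r).A (j - 1) - p).re +
      b * ((cornerPolygon r).A (j - 1) - p).im)
    (h₂ : (cornerPolygon r).A j = p ∨ 0 < a * ((cornerPolygon r).A j - p).re +
      b * ((cornerPolygon r).A j - p).im)
    (h₃ : (cornerPolygon r).S j apex = p ∨ 0 < a * ((cornerPolygon r).S j apex - p).re +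
      b * ((cornerPolygon r).S j apex - p).im) :
    ∃ κ : ℝ, 0 < κ ∧ ∀ z ∈ flatTriangle, κ * ‖(cornerPolygon r).S j z - p‖ ≤
      a * ((cornerPolygon r).S j z - p).re + b * ((cornerPolygon r).S j z - p).im := by
  obtain ⟨κ, hκ, h⟩ := exists_mul_norm_le h₁ h₂ h₃
  refine ⟨κ, hκ, fun z hz => ?_⟩
  have h' := h (1 - z.re - 2 * z.im) (z.re - 2 * z.im) (4 * z.im) (by linarith [hz.2.2])
    (by linarith [hz.2.1]) (by linarith [hz.1]) (by ring)
  convert h' using 4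
  all_goals
    rw [S_eq, S_eq]
    have e : z = (z.re - 2 * z.im : ℝ) + (4 * z.im : ℝ) * apex := by
      apply Complex.ext <;> simp [apex] <;> ring
    have e' : ((1 - z.re - 2 * z.im : ℝ) : ℂ) =
      1 - (z.re - 2 * z.im : ℝ) - (4 * z.im : ℝ) := by push_cast; ring
    rw [e']
    conv_lhs => rw [e]
    ring

theorem abs_re_add_im_le (a b : ℝ) (z : ℂ) : a * z.re + b * z.im ≤ (|a| + |b|) * ‖z‖ := by
  have h1 := Complex.abs_re_le_norm z
  have h2 := Complex.abs_im_le_norm z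
  have h3 : a * z.re ≤ |a| * ‖z‖ := (le_abs_self _).trans
    (by rw [abs_mul]; exact mul_le_mul_of_nonneg_left h1 (abs_nonneg _))
  have h4 : b * z.im ≤ |b| * ‖z‖ := (le_abs_self _).trans
    (by rw [abs_mul]; exact mul_le_mul_of_nonneg_left h2 (abs_nonneg _))
  linarith

/-- Adjacent triangles which are separated by a line through their common vertex, with no other
corner on the line, are in general position. -/
theorem exists_add_dist_le_of_separated {i : ℕ} (a b : ℝ)
    (h₁ : 0 < a * ((cornerPolygon r).A i - (cornerPolygon r).A (i - 1)).re +
      b * ((cornerPolygon r).A i - (cornerPolygon r).A (i - 1)).im)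
    (h₂ : 0 < a * ((cornerPolygon r).A i - (cornerPolygon r).S i apex).re +
      b * ((cornerPolygon r).A i - (cornerPolygon r).S i apex).im)
    (h₃ : 0 < a * ((cornerPolygon r).A (i + 1) - (cornerPolygon r).A i).re +
      b * ((cornerPolygon r).A (i + 1) - (cornerPolygon r).A i).im)
    (h₄ : 0 < a * ((cornerPolygon r).S (i + 1) apex - (cornerPolygon r).A i).re +
      b * ((cornerPolygon r).S (i + 1) apex - (cornerPolygon r).A i).im) :
    ∃ C : ℝ, ∀ z ∈ flatTriangle, ∀ z' ∈ flatTriangle,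
      dist ((cornerPolygon r).S i z) ((cornerPolygon r).A i) +
        dist ((cornerPolygon r).A i) ((cornerPolygon r).S (i + 1) z') ≤
      C * dist ((cornerPolygon r).S i z) ((cornerPolygon r).S (i + 1) z') := by
  obtain ⟨κ, hκ, h⟩ := exists_mul_norm_S_sub_le (r := r) (j := i) (a := -a) (b := -b)
    (p := (cornerPolygon r).A i)
    (Or.inr (by simp only [Complex.sub_re, Complex.sub_im] at *; linarith)) (Or.inl rfl)
    (Or.inr (by simp only [Complex.sub_re, Complex.sub_im] at *; linarith))
  obtain ⟨κ', hκ', h'⟩ := exists_mul_norm_S_sub_le (r := r) (j := i + 1) (a := a) (b := b)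
    (p := (cornerPolygon r).A i) (Or.inl (by rw [Nat.add_sub_cancel]))
    (Or.inr h₃) (Or.inr h₄)
  refine ⟨(|a| + |b|) / min κ κ', fun z hz z' hz' => ?_⟩
  have g := h z hz
  have g' := h' z' hz'
  set x := (cornerPolygon r).S i z
  set y := (cornerPolygon r).S (i + 1) z'
  set p := (cornerPolygon r).A i
  have hm : 0 < min κ κ' := lt_min hκ hκ'
  have g1 := (mul_le_mul_of_nonneg_right (min_le_left κ κ') (norm_nonneg (x - p))).trans g
  have g2 := (mul_le_mul_of_nonneg_right (min_le_right κ κ') (norm_nonneg (y - p))).trans g'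
  have g3 := abs_re_add_im_le a b (y - x)
  rw [div_mul_eq_mul_div, le_div_iff₀ hm, dist_comm p y, dist_comm x y, dist_eq_norm,
    dist_eq_norm, dist_eq_norm]
  simp only [Complex.sub_re, Complex.sub_im] at *
  linarith

theorem exists_add_dist_le (hr : r ∈ Set.Ioo (1 / 3 : ℝ) (4 / 9)) {i : ℕ} (hi : 2 ≤ i)
    (hi' : i + 1 ≤ (cornerPolygon r).ℓ) :
    ∃ C : ℝ, ∀ z ∈ flatTriangle, ∀ z' ∈ flatTriangle,
      dist ((cornerPolygon r).S i z) ((cornerPolygon r).A i) +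
        dist ((cornerPolygon r).A i) ((cornerPolygon r).S (i + 1) z') ≤
      C * dist ((cornerPolygon r).S i z) ((cornerPolygon r).S (i + 1) z') := by
  obtain ⟨hr1, hr2⟩ := hr
  rw [ℓ_eq] at hi'
  have hi4 : i ≤ 4 := by omega
  interval_cases i
  · apply exists_add_dist_le_of_separated 0 1 <;>
      simp only [Nat.reduceSub, Nat.reduceAdd, A_one, A_two, A_three, S_two, S_three, apex,
        Complex.sub_re, Complex.sub_im] <;> norm_num
  · apply exists_add_dist_le_of_separated 1 0 <;>
      simp only [Nat.reduceSub, Nat.reduceAdd, A_two, A_three, A_four, S_three, S_four, apex,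
        Complex.sub_re, Complex.sub_im] <;> linarith
  · apply exists_add_dist_le_of_separated 1 (-1) <;>
      simp only [Nat.reduceSub, Nat.reduceAdd, A_three, A_four, A_five, S_four, S_five, apex,
        Complex.sub_re, Complex.sub_im] <;> linarith

/-- The triangles of the pieces other than the last one touch the right side of the large
triangle at its apex only, under a positive angle. -/
theorem exists_right_side (hr : r ∈ Set.Ioo (1 / 3 : ℝ) (4 / 9)) :
    ∃ κ : ℝ, 0 < κ ∧ ∀ j, 1 ≤ j → j ≤ 4 → ∀ z ∈ flatTriangle,
      κ * ‖(cornerPolygon r).S j z - apex‖ ≤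
        1 - ((cornerPolygon r).S j z).re - 2 * ((cornerPolygon r).S j z).im := by
  obtain ⟨hr1, hr2⟩ := hr
  have key : ∀ j, 1 ≤ j → j ≤ 4 → ∃ κ : ℝ, 0 < κ ∧ ∀ z ∈ flatTriangle,
      κ * ‖(cornerPolygon r).S j z - apex‖ ≤ (-1) * ((cornerPolygon r).S j z - apex).re +
        (-2) * ((cornerPolygon r).S j z - apex).im := by
    intro j hj hj'
    apply exists_mul_norm_S_sub_le <;> interval_cases j <;>
      simp only [Nat.reduceSub, Nat.sub_self, A_zero, A_one, A_two, A_three, A_four, S_one, S_two,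
        S_three, S_four, apex, Complex.sub_re, Complex.sub_im] <;>
      first | exact Or.inl trivial | exact Or.inr (by linarith)
  choose! κ hκ h using key
  refine ⟨min (min (κ 1) (κ 2)) (min (κ 3) (κ 4)), ?_, fun j hj hj' z hz => ?_⟩
  · exact lt_min (lt_min (hκ 1 (by norm_num) (by norm_num)) (hκ 2 (by norm_num) (by norm_num)))
      (lt_min (hκ 3 (by norm_num) (by norm_num)) (hκ 4 (by norm_num) (by norm_num)))
  · have hle : min (min (κ 1) (κ 2)) (min (κ 3) (κ 4)) ≤ κ j := by
      interval_cases j <;> simp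
    refine (mul_le_mul_of_nonneg_right hle (norm_nonneg _)).trans ((h j hj hj' z hz).trans ?_)
    simp only [apex, Complex.sub_re, Complex.sub_im]
    linarith

/-- The triangles of the pieces other than the first one touch the left side of the large
triangle at its apex only, under a positive angle. -/
theorem exists_left_side (hr : r ∈ Set.Ioo (1 / 3 : ℝ) (4 / 9)) :
    ∃ κ : ℝ, 0 < κ ∧ ∀ j, 2 ≤ j → j ≤ 5 → ∀ z ∈ flatTriangle,
      κ * ‖(cornerPolygon r).S j z - apex‖ ≤
        ((cornerPolygon r).S j z).re - 2 * ((cornerPolygon r).S j z).im := by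
  obtain ⟨hr1, hr2⟩ := hr
  have key : ∀ j, 2 ≤ j → j ≤ 5 → ∃ κ : ℝ, 0 < κ ∧ ∀ z ∈ flatTriangle,
      κ * ‖(cornerPolygon r).S j z - apex‖ ≤ 1 * ((cornerPolygon r).S j z - apex).re +
        (-2) * ((cornerPolygon r).S j z - apex).im := by
    intro j hj hj'
    apply exists_mul_norm_S_sub_le <;> interval_cases j <;>
      simp only [Nat.reduceSub, A_one, A_two, A_three, A_four, A_five, S_two,
        S_three, S_four, S_five, apex, Complex.sub_re, Complex.sub_im] <;>
      first | exact Or.inl trivial | exact Or.inr (by linarith)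
  choose! κ hκ h using key
  refine ⟨min (min (κ 2) (κ 3)) (min (κ 4) (κ 5)), ?_, fun j hj hj' z hz => ?_⟩
  · exact lt_min (lt_min (hκ 2 (by norm_num) (by norm_num)) (hκ 3 (by norm_num) (by norm_num)))
      (lt_min (hκ 4 (by norm_num) (by norm_num)) (hκ 5 (by norm_num) (by norm_num)))
  · have hle : min (min (κ 2) (κ 3)) (min (κ 4) (κ 5)) ≤ κ j := by
      interval_cases j <;> simp
    refine (mul_le_mul_of_nonneg_right hle (norm_nonneg _)).trans ((h j hj hj' z hz).trans ?_)
    simp only [apex, Complex.sub_re, Complex.sub_im]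
    linarith

/-- Near the common side of the first two triangles, the pieces at the scales `ρ` and `σ` are not
closer than the points at which they touch this side. -/
theorem exists_abs_sub_le_dist (hr : r ∈ Set.Ioo (1 / 3 : ℝ) (4 / 9)) :
    ∃ C : ℝ, 0 < C ∧ ∀ (i j : ℕ), 1 ≤ i → i ≤ 4 → 2 ≤ j → j ≤ 5 →
      ∀ z ∈ flatTriangle, ∀ z' ∈ flatTriangle, ∀ ρ σ : ℝ, 0 ≤ ρ → 0 ≤ σ →
      |ρ - (2 / 3) ^ 5 * σ| ≤ C * dist
        ((cornerPolygon r).S 1 (1 + ρ * ((cornerPolygon r).S i z - 1)))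
        ((cornerPolygon r).S 2 (σ * (cornerPolygon r).S j z')) := by
  obtain ⟨κ₁, hκ₁, h₁⟩ := exists_right_side hr
  obtain ⟨κ₂, hκ₂, h₂⟩ := exists_left_side hr
  have hκ : 0 < min κ₁ κ₂ := lt_min hκ₁ hκ₂
  refine ⟨9 / 5 * (3 + 9 / min κ₁ κ₂), by positivity,
    fun i j hi hi' hj hj' z hz z' hz' ρ σ hρ hσ => ?_⟩
  set κ := min κ₁ κ₂
  set u := (cornerPolygon r).S i z
  set v := (cornerPolygon r).S j z'
  have g₁ : κ * ‖u - apex‖ ≤ 1 - u.re - 2 * u.im :=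
    (mul_le_mul_of_nonneg_right (min_le_left _ _) (norm_nonneg _)).trans (h₁ i hi hi' z hz)
  have g₂ : κ * ‖v - apex‖ ≤ v.re - 2 * v.im :=
    (mul_le_mul_of_nonneg_right (min_le_right _ _) (norm_nonneg _)).trans (h₂ j hj hj' z' hz')
  set d := (cornerPolygon r).S 2 (σ * v) - (cornerPolygon r).S 1 (1 + ρ * (u - 1)) with hd
  set s := (2 / 3 : ℝ) ^ 5 * σ with hs
  have hs0 : 0 ≤ s := by positivity
  have hdre : d.re = 4 / 9 * (s * (-(3 / 5) * v.re - 4 / 5 * v.im) - ρ * (u.re - 1)) := by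
    rw [hd, S_one, S_two]
    simp only [Complex.sub_re, Complex.add_re, Complex.one_re, Complex.re_ofReal_mul,
      Complex.im_ofReal_mul]
    rw [hs]
    ring
  have hdim : d.im = 4 / 9 * (s * (4 / 5 * v.re - 3 / 5 * v.im) - ρ * u.im) := by
    rw [hd, S_one, S_two]
    simp only [Complex.sub_im, Complex.add_im, Complex.one_im, Complex.re_ofReal_mul,
      Complex.im_ofReal_mul]
    rw [hs]
    ring
  have hN : 1 * d.re + 2 * d.im =
      4 / 9 * (s * (v.re - 2 * v.im) + ρ * (1 - u.re - 2 * u.im)) := by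
    rw [hdre, hdim]; ring
  have hNle := abs_re_add_im_le 1 2 d
  have hPle := abs_re_add_im_le (-2) 1 d
  have hPle' := abs_re_add_im_le 2 (-1) d
  have hu := abs_re_add_im_le (-2) 1 (u - apex)
  have hu' := abs_re_add_im_le 2 (-1) (u - apex)
  have hv := abs_re_add_im_le 2 1 (v - apex)
  have hv' := abs_re_add_im_le (-2) (-1) (v - apex)
  have hare : apex.re = 1 / 2 := rfl
  have haim : apex.im = 1 / 4 := rfl
  have c1 : |(1 : ℝ)| + |2| = 3 := by norm_num
  have c2 : |(-2 : ℝ)| + |1| = 3 := by norm_num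
  have c3 : |(2 : ℝ)| + |-1| = 3 := by norm_num
  have c4 : |(2 : ℝ)| + |1| = 3 := by norm_num
  have c5 : |(-2 : ℝ)| + |-1| = 3 := by norm_num
  simp only [c1, c2, c3] at hNle hPle hPle'
  simp only [Complex.sub_re, Complex.sub_im, hare, haim, c2, c3, c4, c5] at hu hu' hv hv'
  have k₁ := mul_le_mul_of_nonneg_left g₁ hρ
  have k₂ := mul_le_mul_of_nonneg_left g₂ hs0
  have hsum : κ * (s * ‖v - apex‖ + ρ * ‖u - apex‖) ≤ 27 / 4 * ‖d‖ := by linarith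
  have hsum' : s * ‖v - apex‖ + ρ * ‖u - apex‖ ≤ 27 / 4 * ‖d‖ / κ := by
    rw [le_div_iff₀ hκ]; linarith
  have m₁ := mul_le_mul_of_nonneg_left hu hρ
  have m₂ := mul_le_mul_of_nonneg_left hu' hρ
  have m₃ := mul_le_mul_of_nonneg_left hv hs0
  have m₄ := mul_le_mul_of_nonneg_left hv' hs0
  have hP : -2 * d.re + 1 * d.im =
      4 / 9 * (s * (2 * v.re + v.im) - ρ * (-2 * (u.re - 1) + u.im)) := by
    rw [hdre, hdim]; ring
  have hC : 9 / 5 * (3 + 9 / κ) * ‖d‖ = 9 / 5 * (3 * ‖d‖ + 4 / 3 * (27 / 4 * ‖d‖ / κ)) := by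
    ring
  rw [dist_comm, dist_eq_norm, ← hd, abs_le, hC]
  constructor <;> linarith

end cornerPolygon

end RegularArc

namespace RegularArc.cornerPolygon

variable {r : ℝ} {γ : unitInterval → ℂ}

theorem apply_one (hγ : (cornerPolygon r).IsCurve γ) : γ 1 = 1 := hγ.one

theorem S_one_eq (z : ℂ) : (cornerPolygon r).S 1 z = (4 / 9 : ℝ) * z := by
  rw [S_one]; apply Complex.ext <;> simp

theorem S_five_eq (z : ℂ) : (cornerPolygon r).S 5 z = 1 + (r : ℝ) * (z - 1) := by
  rw [S_five]; apply Complex.ext <;> simp; ring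

/-- The points of the arc other than its origin, in terms of the first similitude. -/
theorem exists_apply_eq_pow_mul (hγ : (cornerPolygon r).IsCurve γ) {t : unitInterval}
    (ht : t ≠ 0) : ∃ n j : ℕ, 2 ≤ j ∧ j ≤ 5 ∧ ∃ s,
      γ t = (((4 / 9 : ℝ) ^ n : ℝ) : ℂ) * (cornerPolygon r).S j (γ s) := by
  have ht' : (0 : ℝ) < t := unitInterval.pos_iff_ne_zero.2 ht
  obtain ⟨k, hk⟩ := exists_pow_lt_of_lt_one ht' (by norm_num : (1 / 2 : ℝ) < 1)
  clear ht ht'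
  induction k generalizing t with
  | zero =>
    rw [pow_zero] at hk
    linarith [t.2.2]
  | succ k ih =>
    obtain ⟨j, hj, hj5, t, rfl⟩ := exists_subpart (by norm_num : 0 < 5) t
    have hmap := hγ.map_subpart j hj hj5 t
    rw [ℓ_eq] at hmap
    rcases hj.eq_or_lt with rfl | hj2
    · have h1 := abs_subpart_sub (by norm_num : 2 ≤ 5) hj hj5 0 t
      rw [subpart_first (by norm_num), Set.Icc.coe_zero, sub_zero, sub_zero,
        abs_of_nonneg (subpart 5 1 t).2.1, abs_of_nonneg t.2.1] at h1
      rw [pow_succ'] at hk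
      obtain ⟨n, j, h2, h5, s, hs⟩ := ih (t := t) (by linarith)
      refine ⟨n + 1, j, h2, h5, s, ?_⟩
      rw [hmap, S_one_eq, hs, pow_succ']
      push_cast
      ring
    · exact ⟨0, j, hj2, hj5, t, by rw [hmap]; simp⟩

/-- The points of the arc other than its end, in terms of the last similitude. -/
theorem exists_apply_eq_one_add_pow_mul (hγ : (cornerPolygon r).IsCurve γ) {t : unitInterval}
    (ht : t ≠ 1) : ∃ m j : ℕ, 1 ≤ j ∧ j ≤ 4 ∧ ∃ s,
      γ t = 1 + ((r ^ m : ℝ) : ℂ) * ((cornerPolygon r).S j (γ s) - 1) := by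
  have ht' : (0 : ℝ) < 1 - t := sub_pos.2 (unitInterval.lt_one_iff_ne_one.2 ht)
  obtain ⟨k, hk⟩ := exists_pow_lt_of_lt_one ht' (by norm_num : (1 / 2 : ℝ) < 1)
  clear ht ht'
  induction k generalizing t with
  | zero =>
    rw [pow_zero] at hk
    linarith [t.2.1]
  | succ k ih =>
    obtain ⟨j, hj, hj5, t, rfl⟩ := exists_subpart (by norm_num : 0 < 5) t
    have hmap := hγ.map_subpart j hj hj5 t
    rw [ℓ_eq] at hmap
    rcases hj5.eq_or_lt with rfl | hj4
    · have h1 := abs_subpart_sub (by norm_num : 2 ≤ 5) hj hj5 t 1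
      rw [subpart_last (by norm_num), Set.Icc.coe_one,
        abs_of_nonneg (sub_nonneg.2 (subpart 5 5 t).2.2),
        abs_of_nonneg (sub_nonneg.2 t.2.2)] at h1
      rw [pow_succ'] at hk
      obtain ⟨m, j, h2, h5, s, hs⟩ := ih (t := t) (by linarith)
      refine ⟨m + 1, j, h2, h5, s, ?_⟩
      rw [hmap, S_five_eq, hs, pow_succ']
      push_cast
      ring
    · exact ⟨0, j, hj, by omega, t, by rw [hmap]; simp⟩

theorem exists_apply_eq_pow_mul_apex (hγ : (cornerPolygon r).IsCurve γ) (n : ℕ) :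
    ∃ t, γ t = (((4 / 9 : ℝ) ^ n : ℝ) : ℂ) * apex := by
  induction n with
  | zero =>
    refine ⟨subpart 5 3 1, ?_⟩
    have h := hγ.map_subpart 3 (by norm_num) (by rw [ℓ_eq]; norm_num) 1
    rw [ℓ_eq, hγ.one, Polygon.S_last] at h
    · rw [h, A_three, pow_zero, Complex.ofReal_one, one_mul, apex]
    · rw [ℓ_eq, A_five, A_zero]
      intro h; simpa using congrArg Complex.re h
  | succ n ih =>
    obtain ⟨t, ht⟩ := ih
    refine ⟨subpart 5 1 t, ?_⟩
    have h := hγ.map_subpart 1 (by norm_num) (by rw [ℓ_eq]; norm_num) t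
    rw [ℓ_eq] at h
    rw [h, S_one_eq, ht, pow_succ']
    push_cast
    ring

theorem exists_apply_eq_one_add_pow_mul_apex (hγ : (cornerPolygon r).IsCurve γ) (m : ℕ) :
    ∃ t, γ t = 1 + ((r ^ m : ℝ) : ℂ) * (apex - 1) := by
  induction m with
  | zero =>
    obtain ⟨t, ht⟩ := exists_apply_eq_pow_mul_apex hγ 0
    exact ⟨t, by rw [ht]; simp⟩
  | succ n ih =>
    obtain ⟨t, ht⟩ := ih
    refine ⟨subpart 5 5 t, ?_⟩
    have h := hγ.map_subpart 5 (by norm_num) (by rw [ℓ_eq]) t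
    rw [ℓ_eq] at h
    rw [h, S_five_eq, ht, pow_succ']
    push_cast
    ring

theorem two_thirds_pow_eq (n : ℕ) :
    (2 / 3 : ℝ) ^ (2 * n + 5) = (2 / 3) ^ 5 * (4 / 9) ^ n := by
  rw [pow_add, pow_mul, mul_comm]; norm_num

/-- The position of two points of the first two pieces near their common vertex. -/
theorem exists_corner_bounds (hr : r ∈ Set.Ioo (1 / 3 : ℝ) (4 / 9))
    (hγ : (cornerPolygon r).IsCurve γ) (hγT : ∀ s, γ s ∈ flatTriangle) :
    ∃ C : ℝ, 0 < C ∧ ∀ s t : unitInterval, s ≠ 1 → t ≠ 0 → ∃ m n : ℕ,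
      |r ^ m - (2 / 3) ^ (2 * n + 5)| ≤
        C * dist ((cornerPolygon r).S 1 (γ s)) ((cornerPolygon r).S 2 (γ t)) ∧
      dist ((cornerPolygon r).S 1 (γ s)) ((cornerPolygon r).A 1) +
        dist ((cornerPolygon r).A 1) ((cornerPolygon r).S 2 (γ t)) ≤
        2 * max (r ^ m) ((2 / 3) ^ (2 * n + 5)) := by
  obtain ⟨C, hC, h⟩ := exists_abs_sub_le_dist hr
  refine ⟨C, hC, fun s t hs ht => ?_⟩
  obtain ⟨m, i, hi, hi4, s', hs'⟩ := exists_apply_eq_one_add_pow_mul hγ hs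
  obtain ⟨n, j, hj, hj5, t', ht'⟩ := exists_apply_eq_pow_mul hγ ht
  have hr0 : 0 < r := by linarith [hr.1]
  refine ⟨m, n, ?_, ?_⟩
  · rw [two_thirds_pow_eq, hs', ht']
    exact h i j hi hi4 hj hj5 _ (hγT s') _ (hγT t') _ _ (by positivity) (by positivity)
  · have hu := mapsTo_S hr i hi (by rw [ℓ_eq]; omega) (hγT s')
    have hv := mapsTo_S hr j (by omega) hj5 (hγT t')
    have h1T : (1 : ℂ) ∈ flatTriangle := by rw [← apply_one hγ]; exact hγT 1
    set u := (cornerPolygon r).S i (γ s')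
    set v := (cornerPolygon r).S j (γ t')
    have hl : dist ((cornerPolygon r).S 1 (γ s)) ((cornerPolygon r).A 1) ≤ r ^ m := by
      have e : (cornerPolygon r).S 1 (γ s) - (cornerPolygon r).A 1 =
          ((4 / 9 * r ^ m : ℝ) : ℂ) * (u - 1) := by
        have hA : (cornerPolygon r).A 1 = ((4 / 9 : ℝ) : ℂ) := by
          rw [A_one]; apply Complex.ext <;> simp
        rw [S_one_eq, hs', hA]
        push_cast
        ring
      rw [dist_eq_norm, e, norm_mul, Complex.norm_real, Real.norm_of_nonneg (by positivity),
        ← dist_eq_norm]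
      have := dist_le_two_of_mem_flatTriangle hu h1T
      have hm : 0 < r ^ m := by positivity
      nlinarith
    have hk : dist ((cornerPolygon r).A 1) ((cornerPolygon r).S 2 (γ t)) ≤
        (2 / 3) ^ (2 * n + 5) := by
      obtain ⟨v1, v2, v3⟩ := hv
      rw [two_thirds_pow_eq, dist_comm, dist_eq_norm, ht']
      have hn : (0 : ℝ) < (4 / 9) ^ n := by positivity
      set σ : ℝ := (4 / 9) ^ n
      refine (Complex.norm_le_abs_re_add_abs_im _).trans ?_
      rw [S_two, A_one]
      simp only [Complex.sub_re, Complex.sub_im, Complex.re_ofReal_mul, Complex.im_ofReal_mul]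
      have w1 := mul_nonneg hn.le v1
      have w2 : σ * (2 * v.im) ≤ σ * v.re := mul_le_mul_of_nonneg_left v2 hn.le
      have w3 : σ * (2 * v.im) ≤ σ * (1 - v.re) := mul_le_mul_of_nonneg_left v3 hn.le
      rw [abs_of_nonpos (by linarith), abs_of_nonneg (by linarith)]
      norm_num
      linarith
    linarith [le_max_left (r ^ m) ((2 / 3) ^ (2 * n + 5)),
      le_max_right (r ^ m) ((2 / 3) ^ (2 * n + 5))]

theorem S_eq_A_of_S_eq_S (hr : r ∈ Set.Ioo (1 / 3 : ℝ) (4 / 9))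
    (hγ : (cornerPolygon r).IsCurve γ) (hγT : ∀ s, γ s ∈ flatTriangle)
    (hne : ∀ m n : ℕ, r ^ m ≠ (2 / 3) ^ (2 * n + 5)) {i : ℕ} (hi : 1 ≤ i)
    (hi' : i + 1 ≤ (cornerPolygon r).ℓ) (s t : unitInterval)
    (h : (cornerPolygon r).S i (γ s) = (cornerPolygon r).S (i + 1) (γ t)) :
    (cornerPolygon r).S i (γ s) = (cornerPolygon r).A i := by
  have h0 : (cornerPolygon r).A (cornerPolygon r).ℓ ≠ (cornerPolygon r).A 0 := by
    rw [ℓ_eq, A_five, A_zero]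
    intro h; simpa using congrArg Complex.re h
  rcases hi.eq_or_lt with rfl | hi2
  · by_cases hs : s = 1
    · rw [hs, hγ.one, Polygon.S_last h0]
    by_cases ht : t = 0
    · rw [h, ht, hγ.zero, Polygon.S_first]
    obtain ⟨C, -, hC⟩ := exists_corner_bounds hr hγ hγT
    obtain ⟨m, n, hmn, -⟩ := hC s t hs ht
    rw [h, dist_self, mul_zero] at hmn
    exact absurd (sub_eq_zero.1 (abs_nonpos_iff.1 hmn)) (hne m n)
  · obtain ⟨C, hC⟩ := exists_add_dist_le hr hi2 hi'
    have h1 := hC _ (hγT s) _ (hγT t)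
    rw [← h, dist_self, mul_zero] at h1
    have h2 := dist_nonneg (x := (cornerPolygon r).A i) (y := (cornerPolygon r).S i (γ s))
    exact dist_le_zero.1 (by linarith)

theorem isQuasiArc_of_hasCornerBound (hr : r ∈ Set.Ioo (1 / 3 : ℝ) (4 / 9))
    (hγ : (cornerPolygon r).IsCurve γ)
    (hγT : ∀ s, γ s ∈ flatTriangle) (hinj : Function.Injective γ) {τ : ℝ} (hτ : 1 ≤ τ)
    (hb : HasCornerBound τ r) : IsQuasiArc τ (Set.range γ) := by
  have h0 : (cornerPolygon r).A (cornerPolygon r).ℓ ≠ (cornerPolygon r).A 0 := by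
    rw [ℓ_eq, A_five, A_zero]
    intro h; simpa using congrArg Complex.re h
  -- in a bounded set a linear bound implies the bound with exponent `τ`
  have key : ∀ x K D : ℝ, 0 ≤ x → x ≤ 4 → x ≤ K * D → x ^ τ ≤ 4 ^ (τ - 1) * K * D := by
    intro x K D hx hx4 hxD
    rcases hx.eq_or_lt with rfl | hx
    · rw [Real.zero_rpow (by linarith), mul_assoc]
      exact mul_nonneg (by positivity) hxD
    · have e : x ^ τ = x ^ (τ - 1) * x := by
        rw [← Real.rpow_add_one hx.ne']; congr 1; ring
      rw [e, mul_assoc]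
      exact mul_le_mul (Real.rpow_le_rpow hx.le hx4 (by linarith)) hxD hx.le (by positivity)
  have hmem : ∀ i, 1 ≤ i → i ≤ 5 → ∀ s, (cornerPolygon r).S i (γ s) ∈ flatTriangle :=
    fun i hi hi' s => mapsTo_S hr i hi hi' (hγT s)
  have hle4 : ∀ i, 1 ≤ i → i + 1 ≤ 5 → ∀ s t,
      dist ((cornerPolygon r).S i (γ s)) ((cornerPolygon r).A i) +
        dist ((cornerPolygon r).A i) ((cornerPolygon r).S (i + 1) (γ t)) ≤ 4 := by
    intro i hi hi' s t
    have hA : (cornerPolygon r).A i ∈ flatTriangle := by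
      rw [← Polygon.S_last h0 i, ← hγ.one]; exact hmem i hi (by omega) 1
    linarith [dist_le_two_of_mem_flatTriangle (hmem i hi (by omega) s) hA,
      dist_le_two_of_mem_flatTriangle hA (hmem (i + 1) (by omega) hi' t)]
  refine hγ.isQuasiArc hinj (by rw [ℓ_eq]; norm_num) h0
    (fun j hj hj' => (norm_ratio_lt_one hr j hj hj').le) hτ fun i hi hi' => ?_
  rcases hi.eq_or_lt with rfl | hi2
  · obtain ⟨C, hC, hcorner⟩ := exists_corner_bounds hr hγ hγT
    obtain ⟨C', hC'⟩ := hb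
    refine ⟨4 ^ (τ - 1) * 1 + 2 ^ τ * (|C'| * C), fun s t => ?_⟩
    have hD := dist_nonneg (x := (cornerPolygon r).S 1 (γ s)) (y := (cornerPolygon r).S 2 (γ t))
    have hx := add_nonneg
      (dist_nonneg (x := (cornerPolygon r).S 1 (γ s)) (y := (cornerPolygon r).A 1))
      (dist_nonneg (x := (cornerPolygon r).A 1) (y := (cornerPolygon r).S 2 (γ t)))
    have hK1 : (0 : ℝ) ≤ 4 ^ (τ - 1) * 1 := by positivity
    have hK2 : 0 ≤ 2 ^ τ * (|C'| * C) := by positivity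
    rw [add_mul (4 ^ (τ - 1) * 1)]
    by_cases hst : s = 1 ∨ t = 0
    · refine (key _ 1 _ hx (hle4 1 le_rfl (by norm_num) s t) ?_).trans
        (le_add_of_nonneg_right (mul_nonneg hK2 hD))
      rcases hst with rfl | rfl
      · rw [hγ.one, Polygon.S_last h0, dist_self, zero_add, one_mul]
      · rw [hγ.zero, Polygon.S_first, show 2 - 1 = 1 from rfl, dist_self, add_zero, one_mul]
    · rw [not_or] at hst
      obtain ⟨m, n, h1, h2⟩ := hcorner s t hst.1 hst.2
      have hM : 0 ≤ max (r ^ m) ((2 / 3) ^ (2 * n + 5)) := le_max_of_le_right (by positivity)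
      refine le_trans ?_ (le_add_of_nonneg_left (mul_nonneg hK1 hD))
      calc _ ≤ (2 * max (r ^ m) ((2 / 3) ^ (2 * n + 5))) ^ τ :=
            Real.rpow_le_rpow hx h2 (by linarith)
        _ = 2 ^ τ * max (r ^ m) ((2 / 3) ^ (2 * n + 5)) ^ τ :=
            Real.mul_rpow (by norm_num) hM
        _ ≤ 2 ^ τ * (|C'| * (C * dist ((cornerPolygon r).S 1 (γ s))
              ((cornerPolygon r).S 2 (γ t)))) := by
            refine mul_le_mul_of_nonneg_left ((hC' m n).trans ?_) (by positivity)
            exact mul_le_mul (le_abs_self _) h1 (abs_nonneg _) (abs_nonneg _)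
        _ = _ := by ring
  · obtain ⟨C, hC⟩ := exists_add_dist_le hr hi2 hi'
    exact ⟨4 ^ (τ - 1) * C, fun s t => key _ C _ (add_nonneg dist_nonneg dist_nonneg)
      (hle4 i hi hi' s t) (hC _ (hγT s) _ (hγT t))⟩

theorem hasCornerBound_of_isQuasiArc (hr : r ∈ Set.Ioo (1 / 3 : ℝ) (4 / 9))
    (hγ : (cornerPolygon r).IsCurve γ)
    (hinj : Function.Injective γ) {τ : ℝ} (hτ : 1 ≤ τ) (hq : IsQuasiArc τ (Set.range γ)) :
    HasCornerBound τ r := by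
  obtain ⟨c, hc, hbound⟩ := Polygon.IsCurve.exists_rpow_dist_le hγ.continuous hinj
    (by linarith) hq
  set K : ℝ := 4 / 9 * ‖apex - 1‖ with hK
  have hKpos : 0 < K := by
    have : apex - 1 ≠ 0 := fun h => by simpa [apex] using congrArg Complex.im h
    have := norm_pos_iff.2 this
    positivity
  have hr0 : 0 < r := by linarith [hr.1]
  refine ⟨c * K / K ^ τ, fun m n => ?_⟩
  obtain ⟨s, hs⟩ := exists_apply_eq_one_add_pow_mul_apex hγ m
  obtain ⟨t, ht⟩ := exists_apply_eq_pow_mul_apex hγ n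
  have hx : γ (subpart 5 1 s) = ((4 / 9 : ℝ) : ℂ) + ((4 / 9 * r ^ m : ℝ) : ℂ) * (apex - 1) := by
    have h := hγ.map_subpart 1 (by norm_num) (by rw [ℓ_eq]; norm_num) s
    rw [ℓ_eq] at h
    rw [h, S_one_eq, hs]
    push_cast
    ring
  have hy : γ (subpart 5 2 t) = ((4 / 9 : ℝ) : ℂ) +
      ((4 / 9 * (2 / 3) ^ (2 * n + 5) : ℝ) : ℂ) * (apex - 1) := by
    have h := hγ.map_subpart 2 (by norm_num) (by rw [ℓ_eq]; norm_num) t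
    rw [ℓ_eq] at h
    rw [h, S_two, ht, two_thirds_pow_eq]
    generalize (4 / 9 : ℝ) ^ n = σ
    apply Complex.ext
    · simp only [Complex.re_ofReal_mul, Complex.im_ofReal_mul, Complex.add_re, Complex.ofReal_re,
        Complex.sub_re, Complex.one_re, apex]
      ring
    · simp only [Complex.re_ofReal_mul, Complex.im_ofReal_mul, Complex.add_im, Complex.ofReal_im,
        Complex.sub_im, Complex.one_im, apex]
      ring
  have hz : γ (subpart 5 1 1) = ((4 / 9 : ℝ) : ℂ) := by
    have h := hγ.map_subpart 1 (by norm_num) (by rw [ℓ_eq]; norm_num) 1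
    rw [ℓ_eq] at h
    rw [h, S_one_eq, apply_one hγ, mul_one]
  set ρ := r ^ m
  set σ : ℝ := (2 / 3) ^ (2 * n + 5)
  have hρ : 0 < ρ := by positivity
  have hσ : 0 < σ := by positivity
  have dxy : dist (γ (subpart 5 1 s)) (γ (subpart 5 2 t)) = K * |ρ - σ| := by
    rw [dist_eq_norm, hx, hy, add_sub_add_left_eq_sub, ← sub_mul, ← Complex.ofReal_sub, norm_mul,
      Complex.norm_real, ← mul_sub, Real.norm_eq_abs, abs_mul, hK, abs_of_pos (by norm_num)]
    ring
  have dxz : dist (γ (subpart 5 1 s)) (γ (subpart 5 1 1)) = K * ρ := by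
    rw [dist_eq_norm, hx, hz, add_sub_cancel_left, norm_mul, Complex.norm_real,
      Real.norm_of_nonneg (by positivity), hK]
    ring
  have dyz : dist (γ (subpart 5 2 t)) (γ (subpart 5 1 1)) = K * σ := by
    rw [dist_eq_norm, hy, hz, add_sub_cancel_left, norm_mul, Complex.norm_real,
      Real.norm_of_nonneg (by positivity), hK]
    ring
  have hmem : subpart 5 1 1 ∈ Set.uIcc (subpart 5 1 s) (subpart 5 2 t) := by
    refine Set.mem_uIcc_of_le ?_ ?_
    · exact (subpart_le_subpart_iff le_rfl (by norm_num)).2 unitInterval.le_one'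
    · exact subpart_le_subpart le_rfl (by norm_num) (by norm_num) _ _
  have b1 := hbound _ _ _ hmem
  have b2 := hbound _ _ _ (Set.uIcc_comm (subpart 5 1 s) _ ▸ hmem)
  rw [dxz, dxy, Real.mul_rpow hKpos.le hρ.le] at b1
  rw [dyz, dist_comm, dxy, Real.mul_rpow hKpos.le hσ.le] at b2
  have hKτ : 0 < K ^ τ := Real.rpow_pos_of_pos hKpos τ
  rw [div_mul_eq_mul_div, le_div_iff₀ hKτ]
  rcases max_cases ρ σ with ⟨h, -⟩ | ⟨h, -⟩ <;> rw [h] <;> linarith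

/-- When the two sequences of distances are disjoint, the polygon generates a regular arc, and
the corner bound decides whether it is a quasi-arc. -/
theorem exists_generatesRegularArc (hr : r ∈ Set.Ioo (1 / 3 : ℝ) (4 / 9))
    (hne : ∀ m n : ℕ, r ^ m ≠ (2 / 3) ^ (2 * n + 5)) :
    ∃ Λ, (cornerPolygon r).GeneratesRegularArc Λ ∧
      ∀ τ : ℝ, 1 ≤ τ → (IsQuasiArc τ Λ ↔ HasCornerBound τ r) := by
  have hl : 2 ≤ (cornerPolygon r).ℓ := by rw [ℓ_eq]; norm_num
  have h0 : (cornerPolygon r).A (cornerPolygon r).ℓ ≠ (cornerPolygon r).A 0 := by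
    rw [ℓ_eq, A_five, A_zero]
    intro h; simpa using congrArg Complex.re h
  obtain ⟨γ, hγ, hγT⟩ := Polygon.exists_isCurve (by omega) h0 (norm_ratio_lt_one hr)
    isClosed_flatTriangle (by
      rw [← convexHull_eq_flatTriangle]
      exact (convex_convexHull ℝ _).segment_subset (subset_convexHull ℝ _ (by simp [A_zero]))
        (subset_convexHull ℝ _ (by simp [ℓ_eq, A_five]))) (mapsTo_S hr)
  have hdis : ∀ i j, 1 ≤ i → i + 1 < j → j ≤ (cornerPolygon r).ℓ → ∀ s t,
      (cornerPolygon r).S i (γ s) ≠ (cornerPolygon r).S j (γ t) :=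
    fun i j hi hij hj s t => S_ne_S hr hi hij hj (hγT s) (hγT t)
  have hsucc := fun i (hi : 1 ≤ i) (hi' : i + 1 ≤ (cornerPolygon r).ℓ) =>
    S_eq_A_of_S_eq_S hr hγ hγT hne hi hi'
  have hinj := hγ.injective hl (injOn_A hr) hdis hsucc
  exact ⟨Set.range γ, ⟨isBasicFigure hr, characteristicAngle_pos hr,
    hγ.isSelfSimilarArc hl (injOn_A hr) hdis hsucc⟩, fun τ hτ =>
    ⟨hasCornerBound_of_isQuasiArc hr hγ hinj hτ, isQuasiArc_of_hasCornerBound hr hγ hγT hinj hτ⟩⟩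

end RegularArc.cornerPolygon

theorem theorem7p15 :
    (∃ (P : RegularArc.Polygon) (Λ : Set ℂ), P.GeneratesRegularArc Λ ∧ P.thetaMin = 0 ∧
      ∀ t : ℝ, 1 ≤ t → ¬ RegularArc.IsQuasiArc t Λ) ∧
    (∀ t₀ : ℝ, 1 < t₀ →
      ∃ (P : RegularArc.Polygon) (Λ : Set ℂ), P.GeneratesRegularArc Λ ∧ P.thetaMin = 0 ∧
        RegularArc.IsQuasiArc t₀ Λ ∧
        ∀ t : ℝ, 1 ≤ t → t < t₀ → ¬ RegularArc.IsQuasiArc t Λ) ∧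
    (∀ t₀ : ℝ, 1 ≤ t₀ →
      ∃ (P : RegularArc.Polygon) (Λ : Set ℂ), P.GeneratesRegularArc Λ ∧ P.thetaMin = 0 ∧
        (∀ t : ℝ, t₀ < t → RegularArc.IsQuasiArc t Λ) ∧
        ¬ RegularArc.IsQuasiArc t₀ Λ) := by
  refine ⟨?_, fun t₀ ht₀ => ?_, fun t₀ ht₀ => ?_⟩
  · obtain ⟨r, hr, hne, h⟩ := RegularArc.exists_forall_not_hasCornerBound
    obtain ⟨Λ, hΛ, hq⟩ := RegularArc.cornerPolygon.exists_generatesRegularArc hr hne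
    exact ⟨_, Λ, hΛ, RegularArc.cornerPolygon.thetaMin_eq_zero r,
      fun t ht => mt (hq t ht).1 (h t ht)⟩
  · obtain ⟨r, hr, hne, h₀, h⟩ := RegularArc.exists_hasCornerBound_iff_le ht₀
    obtain ⟨Λ, hΛ, hq⟩ := RegularArc.cornerPolygon.exists_generatesRegularArc hr hne
    exact ⟨_, Λ, hΛ, RegularArc.cornerPolygon.thetaMin_eq_zero r, (hq t₀ ht₀.le).2 h₀,
      fun t ht htt => mt (hq t ht).1 (h t ht htt)⟩
  · obtain ⟨r, hr, hne, h, h₀⟩ := RegularArc.exists_hasCornerBound_iff_lt ht₀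
    obtain ⟨Λ, hΛ, hq⟩ := RegularArc.cornerPolygon.exists_generatesRegularArc hr hne
    exact ⟨_, Λ, hΛ, RegularArc.cornerPolygon.thetaMin_eq_zero r,
      fun t ht => (hq t (ht₀.trans ht.le)).2 (h t ht), mt (hq t₀ ht₀).1 h₀⟩
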